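/- **Setting.** Use $\widehat f(\xi)=\int f(t)e^{-2\pi i t\xi}\,dt$, extended to tempered distributions by duality. For a bounded operator $H$ on $L^2(\mathbb R)$, the Kohn–Nirenberg symbol of $H$ is the tempered distribution $\sigma_H$ on $\mathbb R^2$ with $Hf(x)=\int\sigma_H(x,\xi)\widehat f(\xi)e^{2\pi i x\xi}\,d\xi$ in the weak sense, for all Schwartz functions $f$. The symplectic Fourier transform $\mathcal F_s\sigma(t,\gamma)=\iint\sigma(x,\xi)e^{-2\pi i(x\gamma-t\xi)}\,dx\,d\xi$ is extended to tempered distributions by duality. For $M\subseteq\mathbb R^2$ let $$OPW(M)=\{H\in\mathcal L(L^2(\mathbb R)):\ \operatorname{supp}\mathcal F_s\sigma_H\subseteq M\}.$$ If $M$ is compact, each $H\in OPW(M)$ acts on a tempered distribution $w$ by duality: $\langle Hw,g\rangle=\langle w,H^{t}g\rangle$ for Schwartz $g$, where the transpose $H^t$ (given by $\int (Hf)g=\int f\,(H^tg)$) maps the Schwartz space continuously into itself. For compact $M$, a tempered distribution $w$ on $\mathbb R$ *identifies* $OPW(M)$ if there are constants $A,B>0$ such that, for all $H\in OPW(M)$,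 $Hw\in L^2(\mathbb R)$ and $$A\,\|H\|_{\mathcal L(L^2)}\le\|Hw\|_{L^2(\mathbb R)}\le B\,\|H\|_{\mathcal L(L^2)}.$$ It *identifies the Hilbert–Schmidt operators in* $OPW(M)$ if there are $A,B>0$ such that, for all $H\in OPW(M)$ with $\sigma_H\in L^2(\mathbb R^2)$, $Hw\in L^2(\mathbb R)$ and $$A\,\|\sigma_H\|_{L^2(\mathbb R^2)}\le\|Hw\|_{L^2(\mathbb R)}\le B\,\|\sigma_H\|_{L^2(\mathbb R^2)}$$ (here $\|\sigma_H\|_{L^2(\mathbb R^2)}$ is the Hilbert–Schmidt norm of $H$). **Theorem.** Let $T,\Omega>0$ and let $w$ be a tempered distribution on $\mathbb R$ that identifies $OPW([0,T]\times[-\Omega/2,\Omega/2])$, or that identifies the Hilbert–Schmidt operators in $OPW([0,T]\times[-\Omega/2,\Omega/2])$. Then $w$ decays weakly neither in time nor in frequency, in either direction. That is, none of the following four statements holds: 1. $\langle w,\varphi(\cdot-x)\rangle\to0$ as $x\to+\infty$, for all Schwartz functions $\varphi$; 2. $\langle w,\varphi(\cdot-x)\rangle\to0$ as $x\to-\infty$,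 for all Schwartz functions $\varphi$; 3. $\langle\widehat w,\varphi(\cdot-\xi)\rangle\to0$ as $\xi\to+\infty$, for all Schwartz functions $\varphi$; 4. $\langle\widehat w,\varphi(\cdot-\xi)\rangle\to0$ as $\xi\to-\infty$, for all Schwartz functions $\varphi$. -/

import Mathlib

open MeasureTheory Filter Topology
open scoped SchwartzMap FourierTransform ENNReal

noncomputable section

namespace OperatorPW

/-- The Hilbert space `L²(ℝ)` of complex-valued functions. -/
abbrev L2R : Type := Lp ℂ 2 (volume : Measure ℝ)

/-- The plane `ℝ²`, used both for the variables `(x, ξ)` and for the variables `(t, γ)`. -/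
abbrev Plane : Type := EuclideanSpace ℝ (Fin 2)

/-- The Hilbert space `L²(ℝ²)`. -/
abbrev L2Plane : Type := Lp ℂ 2 (volume : Measure Plane)

/-! ### Schwartz functions on the plane -/

theorem coord_iteratedFDeriv_le (f : 𝓢(ℝ, ℂ)) (i : Fin 2) (n : ℕ) (z : Plane) :
    ‖iteratedFDeriv ℝ n (fun y : Plane => f (y i)) z‖ ≤ ‖iteratedFDeriv ℝ n f (z i)‖ := by
  have h := (EuclideanSpace.proj i : Plane →L[ℝ] ℝ).iteratedFDeriv_comp_right
    (f := f) (n := (n : ℕ∞)) (f.smooth n) z (i := n) le_rfl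
  have hp : ‖(EuclideanSpace.proj i : Plane →L[ℝ] ℝ)‖ ≤ 1 := by
    refine ContinuousLinearMap.opNorm_le_bound _ zero_le_one fun y => ?_
    simpa using PiLp.norm_apply_le y i
  change ‖iteratedFDeriv ℝ n (f ∘ (EuclideanSpace.proj i : Plane →L[ℝ] ℝ)) z‖ ≤ _
  rw [h]
  refine (ContinuousMultilinearMap.norm_compContinuousLinearMap_le _ _).trans ?_
  have h1 : ∏ _j : Fin n, ‖(EuclideanSpace.proj i : Plane →L[ℝ] ℝ)‖ ≤ 1 :=
    Finset.prod_le_one (fun _ _ => norm_nonneg _) fun _ _ => hp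
  exact mul_le_of_le_one_right (norm_nonneg _) h1

theorem norm_plane_le (z : Plane) : ‖z‖ ≤ (1 + ‖z 0‖) * (1 + ‖z 1‖) := by
  have h0 := norm_nonneg (z 0)
  have h1 := norm_nonneg (z 1)
  rw [EuclideanSpace.norm_eq, Fin.sum_univ_two]
  refine Real.sqrt_le_iff.2 ⟨by positivity, ?_⟩
  nlinarith [mul_nonneg h0 h1, sq_nonneg (‖z 0‖ * ‖z 1‖), mul_nonneg (mul_nonneg h0 h1) h0,
    mul_nonneg (mul_nonneg h0 h1) h1]

/-- The tensor product `(g ⊗ h)(x, ξ) = g x * h ξ` of two Schwartz functions. -/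
def tensor (g h : 𝓢(ℝ, ℂ)) : 𝓢(Plane, ℂ) where
  toFun z := g (z 0) * h (z 1)
  smooth' := by
    have h0 : ContDiff ℝ (⊤ : ℕ∞) (fun z : Plane => g (z 0)) :=
      (g.smooth _).comp (EuclideanSpace.proj (0 : Fin 2) : Plane →L[ℝ] ℝ).contDiff
    have h1 : ContDiff ℝ (⊤ : ℕ∞) (fun z : Plane => h (z 1)) :=
      (h.smooth _).comp (EuclideanSpace.proj (1 : Fin 2) : Plane →L[ℝ] ℝ).contDiff
    exact h0.mul h1
  decay' := by
    intro k n
    have h0 : ContDiff ℝ (⊤ : ℕ∞) (fun z : Plane => g (z 0)) :=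
      (g.smooth _).comp (EuclideanSpace.proj (0 : Fin 2) : Plane →L[ℝ] ℝ).contDiff
    have h1 : ContDiff ℝ (⊤ : ℕ∞) (fun z : Plane => h (z 1)) :=
      (h.smooth _).comp (EuclideanSpace.proj (1 : Fin 2) : Plane →L[ℝ] ℝ).contDiff
    let S : 𝓢(ℝ, ℂ) → ℝ := fun f =>
      2 ^ k * (Finset.Iic (k, n)).sup (fun m => SchwartzMap.seminorm ℝ m.1 m.2) f
    have hS : ∀ (f : 𝓢(ℝ, ℂ)) (j : ℕ), j ≤ n → ∀ x : ℝ,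
        (1 + ‖x‖) ^ k * ‖iteratedFDeriv ℝ j f x‖ ≤ S f := fun f j hj x =>
      SchwartzMap.one_add_le_sup_seminorm_apply (m := (k, n)) le_rfl hj f x
    refine ⟨∑ i ∈ Finset.range (n + 1), (n.choose i : ℝ) * (S g * S h), fun z => ?_⟩
    have hb := norm_iteratedFDeriv_mul_le (𝕜 := ℝ) h0 h1 z (n := n)
      (by exact_mod_cast le_top)
    calc ‖z‖ ^ k * ‖iteratedFDeriv ℝ n (fun z : Plane => g (z 0) * h (z 1)) z‖
        ≤ ((1 + ‖z 0‖) * (1 + ‖z 1‖)) ^ k * ∑ i ∈ Finset.range (n + 1), (n.choose i : ℝ) *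
            ‖iteratedFDeriv ℝ i (fun z : Plane => g (z 0)) z‖ *
            ‖iteratedFDeriv ℝ (n - i) (fun z : Plane => h (z 1)) z‖ := by
          gcongr
          exact norm_plane_le z
      _ ≤ _ := by
          rw [Finset.mul_sum]
          refine Finset.sum_le_sum fun i hi => ?_
          have hi' : i ≤ n := Nat.lt_succ_iff.1 (Finset.mem_range.1 hi)
          have e0 := hS g i hi' (z 0)
          have e1 := hS h (n - i) (Nat.sub_le _ _) (z 1)
          have c0 := coord_iteratedFDeriv_le g 0 i z
          have c1 := coord_iteratedFDeriv_le h 1 (n - i) z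
          calc _ ≤ ((1 + ‖z 0‖) * (1 + ‖z 1‖)) ^ k * ((n.choose i : ℝ) *
                ‖iteratedFDeriv ℝ i g (z 0)‖ * ‖iteratedFDeriv ℝ (n - i) h (z 1)‖) := by
                gcongr
            _ = (n.choose i : ℝ) * (((1 + ‖z 0‖) ^ k * ‖iteratedFDeriv ℝ i g (z 0)‖) *
                ((1 + ‖z 1‖) ^ k * ‖iteratedFDeriv ℝ (n - i) h (z 1)‖)) := by
                rw [mul_pow]; ring
            _ ≤ _ := by
                have : 0 ≤ S g := le_trans (by positivity) e0
                gcongr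

@[simp]
theorem tensor_apply (g h : 𝓢(ℝ, ℂ)) (z : Plane) : tensor g h z = g (z 0) * h (z 1) := rfl

/-- The chirp `(x, ξ) ↦ e^{2πi x ξ}`. -/
def chirp (z : Plane) : ℂ := Complex.exp ((2 * Real.pi * (z 0 * z 1) : ℝ) * Complex.I)

theorem iteratedDeriv_expI (n : ℕ) :
    iteratedDeriv n (fun t : ℝ => Complex.exp (t * Complex.I)) =
      fun t : ℝ => Complex.I ^ n * Complex.exp (t * Complex.I) := by
  induction n with
  | zero => simp
  | succ n ih =>
    rw [iteratedDeriv_succ, ih]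
    funext t
    have h1 : HasDerivAt (fun t : ℝ => (t : ℂ) * Complex.I) (1 * Complex.I) t :=
      (Complex.ofRealCLM.hasDerivAt (x := t)).mul_const Complex.I
    rw [(h1.cexp.const_mul (Complex.I ^ n)).deriv]
    ring

theorem chirp_hasTemperateGrowth : chirp.HasTemperateGrowth := by
  have h1 : Function.HasTemperateGrowth (fun t : ℝ => Complex.exp (t * Complex.I)) := by
    refine ⟨?_, fun n => ⟨0, 1, fun t => ?_⟩⟩
    · exact (Complex.ofRealCLM.contDiff.mul contDiff_const).cexp
    · rw [norm_iteratedFDeriv_eq_norm_iteratedDeriv, iteratedDeriv_expI]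
      simp [Complex.norm_exp]
  have h2 : Function.HasTemperateGrowth (fun z : Plane => 2 * Real.pi * (z 0 * z 1)) :=
    (Function.HasTemperateGrowth.const (2 * Real.pi)).mul
      ((EuclideanSpace.proj (0 : Fin 2) : Plane →L[ℝ] ℝ).hasTemperateGrowth.mul
        (EuclideanSpace.proj (1 : Fin 2) : Plane →L[ℝ] ℝ).hasTemperateGrowth)
  exact h1.comp h2

/-- The test function `(x, ξ) ↦ g x * 𝓕 f ξ * e^{2πi x ξ}`, see `knTest_apply`. -/
def knTest (f g : 𝓢(ℝ, ℂ)) : 𝓢(Plane, ℂ) :=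
  SchwartzMap.smulLeftCLM ℂ chirp (tensor g (𝓕 f))

theorem knTest_apply (f g : 𝓢(ℝ, ℂ)) (z : Plane) :
    knTest f g z = chirp z * (g (z 0) * 𝓕 f (z 1)) := by
  simp [knTest, SchwartzMap.smulLeftCLM_apply_apply chirp_hasTemperateGrowth]

/-! ### Kohn-Nirenberg symbol, symplectic Fourier transform, operator Paley-Wiener space -/

/-- `σ` is the Kohn-Nirenberg symbol of the bounded operator `H` on `L²(ℝ)`:
`H f (x) = ∫ σ(x, ξ) 𝓕f(ξ) e^{2πi x ξ} dξ` weakly, that is, for all Schwartz functions `f, g`,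
`∫ H f (x) g(x) dx = ⟨σ, (x, ξ) ↦ g(x) 𝓕f(ξ) e^{2πi x ξ}⟩` with bilinear pairings. -/
def IsKNSymbol (H : L2R →L[ℂ] L2R) (σ : 𝓢'(Plane, ℂ)) : Prop :=
  ∀ f g : 𝓢(ℝ, ℂ), Lp.toTemperedDistribution (H (f.toLp 2)) g = σ (knTest f g)

/-- The rotation `(x, ξ) ↦ (-ξ, x)` of the plane. -/
def rot : Plane ≃L[ℝ] Plane :=
  LinearEquiv.toContinuousLinearEquiv
    { toFun := fun z => !₂[-z 1, z 0]
      invFun := fun z => !₂[z 1, -z 0]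
      map_add' := fun y z => by
        ext i
        fin_cases i
        · simp [add_comm]
        · simp
      map_smul' := fun c z => by
        ext i
        fin_cases i <;> simp
      left_inv := fun z => by
        ext i
        fin_cases i <;> simp
      right_inv := fun z => by
        ext i
        fin_cases i <;> simp }

/-- The transpose of the symplectic Fourier transform on Schwartz functions,
`ψ ↦ ((x, ξ) ↦ ∫∫ ψ(t, γ) e^{-2πi (x γ - t ξ)} dt dγ)`, see `sympFourierTest_apply`. -/
def sympFourierTest : 𝓢(Plane, ℂ) →L[ℂ] 𝓢(Plane, ℂ) :=
  (SchwartzMap.compCLMOfContinuousLinearEquiv ℂ rot).comp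
    (FourierTransform.fourierCLM ℂ 𝓢(Plane, ℂ))

theorem sympFourierTest_apply (ψ : 𝓢(Plane, ℂ)) (z : Plane) :
    sympFourierTest ψ z =
      ∫ v : Plane, Complex.exp (-2 * Real.pi * Complex.I * (z 0 * v 1 - v 0 * z 1)) * ψ v := by
  change (𝓕 ψ) (rot z) = _
  rw [SchwartzMap.fourier_coe, Real.fourier_eq']
  refine integral_congr_ae (Filter.Eventually.of_forall fun v => ?_)
  have : inner ℝ v (rot z) = z 0 * v 1 - v 0 * z 1 := by
    simp [rot, PiLp.inner_apply, Fin.sum_univ_two]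
    ring
  simp only [this, smul_eq_mul]
  congr 2
  push_cast
  ring

/-- The symplectic Fourier transform of tempered distributions on the plane, the extension by
duality of `(𝓕ₛ σ)(t, γ) = ∫∫ σ(x, ξ) e^{-2πi (x γ - t ξ)} dx dξ`. -/
def sympFourier (σ : 𝓢'(Plane, ℂ)) : 𝓢'(Plane, ℂ) :=
  PointwiseConvergenceCLM.precomp ℂ sympFourierTest σ

/-- The operator Paley-Wiener space `OPW(M)`: the bounded operators on `L²(ℝ)` for which the
symplectic Fourier transform of the Kohn-Nirenberg symbol (i.e. the spreading function) is
supported in `M`. -/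
def OPW (M : Set Plane) : Set (L2R →L[ℂ] L2R) :=
  {H | ∃ σ : 𝓢'(Plane, ℂ), IsKNSymbol H σ ∧ Distribution.dsupport (sympFourier σ) ⊆ M}

/-- The rectangle `[0, T] × [-Ω/2, Ω/2]` in the `(t, γ)`-plane. -/
def rectangle (T Ω : ℝ) : Set Plane :=
  {z | z 0 ∈ Set.Icc 0 T ∧ z 1 ∈ Set.Icc (-Ω / 2) (Ω / 2)}

/-! ### Response of an operator to a tempered distribution, identification -/

/-- `u = H w`, where `w` is a tempered distribution and `u ∈ L²(ℝ)`.  As usual, `H` acts on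
tempered distributions by duality: the transpose `P` of `H`, given by
`∫ (H f) g = ∫ f (P g)` for `f ∈ L²(ℝ)`, maps the Schwartz space continuously into itself, and
`⟨H w, g⟩ = ⟨w, P g⟩` for all Schwartz functions `g`.  Such a `P` exists whenever the spreading
function of `H` has compact support, and it is unique. -/
def IsResponse (H : L2R →L[ℂ] L2R) (w : 𝓢'(ℝ, ℂ)) (u : L2R) : Prop :=
  ∃ P : 𝓢(ℝ, ℂ) →L[ℂ] 𝓢(ℝ, ℂ),
    (∀ (f : L2R) (g : 𝓢(ℝ, ℂ)),
      Lp.toTemperedDistribution (H f) g = Lp.toTemperedDistribution f (P g)) ∧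
    ∀ g : 𝓢(ℝ, ℂ), Lp.toTemperedDistribution u g = w (P g)

/-- `w` identifies `OPW(M)`: `H w ∈ L²(ℝ)` and `A ‖H‖ ≤ ‖H w‖₂ ≤ B ‖H‖` (operator norm) for all
`H ∈ OPW(M)`, with constants `A, B > 0`. -/
def Identifies (w : 𝓢'(ℝ, ℂ)) (M : Set Plane) : Prop :=
  ∃ A B : ℝ, 0 < A ∧ 0 < B ∧ ∀ H ∈ OPW M,
    ∃ u : L2R, IsResponse H w u ∧ A * ‖H‖ ≤ ‖u‖ ∧ ‖u‖ ≤ B * ‖H‖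

/-- `w` identifies the Hilbert-Schmidt operators in `OPW(M)`, i.e. those whose Kohn-Nirenberg
symbol is some `s ∈ L²(ℝ²)`: `H w ∈ L²(ℝ)` and `A ‖s‖₂ ≤ ‖H w‖₂ ≤ B ‖s‖₂` for all such `H`, with
constants `A, B > 0`.  Here `‖s‖₂` is the Hilbert-Schmidt norm of `H`. -/
def IdentifiesHilbertSchmidt (w : 𝓢'(ℝ, ℂ)) (M : Set Plane) : Prop :=
  ∃ A B : ℝ, 0 < A ∧ 0 < B ∧ ∀ H ∈ OPW M, ∀ s : L2Plane,
    IsKNSymbol H (Lp.toTemperedDistribution s) →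
      ∃ u : L2R, IsResponse H w u ∧ A * ‖s‖ ≤ ‖u‖ ∧ ‖u‖ ≤ B * ‖s‖

end OperatorPW

end

/-! The operator class is invariant under translation in time and in frequency, while the response
to a weakly decaying `w` is not. Take a Fourier multiplier `α`, then multiplication by `m`, with `𝓕⁻
α` supported in `[0, T]` and `𝓕 m` in `[-Ω/2, Ω/2]`. Replacing `m` by `m(· - x)` only multiplies `𝓕
m` by a phase, so the operator stays in `OPW`. Its response to `w` is `y ↦ m(y - x) ⟨w, (𝓕 α)(· -
y)⟩` (`norm_sq_response_mulMultiplier`). The second factor grows at most polynomially; if it tends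
to 0 in the direction of `x`, dominated convergence sends the `L²` norm of the response to 0
(`tendsto_integral_translate`).

A matrix coefficient with equally translated test functions does not depend on `x`. It is bounded by
the operator norm and by the Hilbert–Schmidt norm, so the lower bound in either kind of
identification keeps the response away from 0 (`exists_lower_bound_of_identifies`), a contradiction.

For decay in frequency the factors are composed in the other order and `α` is translated. The
Fourier transform of the response is then `ξ ↦ α(ξ - ν) ⟨𝓕 w, (𝓕⁻ m)(· - ξ)⟩`, and the argument
repeats.

The response formulas rest on `⟨w, k * φ⟩ = ∫ k(y) ⟨w, φ(· - y)⟩ dy` (`apply_convolution`), proved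
by factoring `w` through a Banach space. -/

noncomputable section

namespace SchwartzMap

/-! ### Translates of Schwartz functions -/

theorem one_add_abs_pow_mul_norm_le (ψ : 𝓢(ℝ, ℂ)) (k : ℕ) :
    ∃ C : ℝ, 0 ≤ C ∧ ∀ x : ℝ, (1 + |x|) ^ k * ‖ψ x‖ ≤ C := by
  refine ⟨2 ^ k * (Finset.Iic (k, 0)).sup (fun m => SchwartzMap.seminorm ℝ m.1 m.2) ψ,
    mul_nonneg (by positivity) (apply_nonneg _ _), fun x => ?_⟩
  simpa using one_add_le_sup_seminorm_apply (𝕜 := ℝ) (m := (k, 0)) le_rfl le_rfl ψ x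

theorem abs_pow_mul_norm_sub_le (ψ : 𝓢(ℝ, ℂ)) (k : ℕ) :
    ∃ C : ℝ, 0 ≤ C ∧ ∀ x y : ℝ, |x| ^ k * ‖ψ (x - y)‖ ≤ C * (1 + |y|) ^ k := by
  obtain ⟨C, hC, h⟩ := one_add_abs_pow_mul_norm_le ψ k
  refine ⟨C, hC, fun x y => ?_⟩
  -- Peetre's inequality moves the weight from `x` to the translation parameter.
  have h1 : |x| ≤ (1 + |x - y|) * (1 + |y|) := by
    have : |x| ≤ |x - y| + |y| := by simpa using abs_add_le (x - y) y
    nlinarith [abs_nonneg (x - y), abs_nonneg y, mul_nonneg (abs_nonneg (x - y)) (abs_nonneg y)]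
  calc |x| ^ k * ‖ψ (x - y)‖ ≤ ((1 + |x - y|) * (1 + |y|)) ^ k * ‖ψ (x - y)‖ := by gcongr
    _ = ((1 + |x - y|) ^ k * ‖ψ (x - y)‖) * (1 + |y|) ^ k := by rw [mul_pow]; ring
    _ ≤ _ := by gcongr; exact h _

/-- Mean value inequality in the translation parameter, with the derivative bounded by the previous
lemma. It makes translation continuous for each Schwartz seminorm. -/
theorem abs_pow_mul_norm_sub_sub_le (ψ : 𝓢(ℝ, ℂ)) (k : ℕ) :
    ∃ C : ℝ, 0 ≤ C ∧ ∀ x y z : ℝ,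
      |x| ^ k * ‖ψ (x - y) - ψ (x - z)‖ ≤ C * (1 + |y| + |z|) ^ k * |y - z| := by
  obtain ⟨C, hC, h⟩ := abs_pow_mul_norm_sub_le (derivCLM ℂ ℂ ψ) k
  refine ⟨C, hC, fun x y z => ?_⟩
  have hd : ∀ t ∈ Set.uIcc y z, HasDerivWithinAt (fun t => (|x| ^ k : ℝ) • ψ (x - t))
      ((|x| ^ k : ℝ) • -(deriv ψ (x - t))) (Set.uIcc y z) t := fun t _ => by
    have h1 := (ψ.hasDerivAt (x - t)).scomp t ((hasDerivAt_id t).const_sub x)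
    have h2 := (h1.const_smul (|x| ^ k : ℝ)).hasDerivWithinAt (s := Set.uIcc y z)
    rw [neg_one_smul] at h2
    exact h2
  have hb : ∀ t ∈ Set.uIcc y z, ‖(|x| ^ k : ℝ) • -(deriv ψ (x - t))‖ ≤
      C * (1 + |y| + |z|) ^ k := fun t ht => by
    have ht' : |t| ≤ |y| + |z| := by
      rcases Set.mem_uIcc.1 ht with ⟨h1, h2⟩ | ⟨h1, h2⟩ <;>
      · refine abs_le.2 ⟨?_, ?_⟩ <;>
          linarith [neg_abs_le y, neg_abs_le z, le_abs_self y, le_abs_self z,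
            abs_nonneg y, abs_nonneg z]
    calc ‖(|x| ^ k : ℝ) • -(deriv ψ (x - t))‖ = |x| ^ k * ‖derivCLM ℂ ℂ ψ (x - t)‖ := by
          simp
      _ ≤ C * (1 + |t|) ^ k := h x t
      _ ≤ _ := by
        gcongr ?_ * ?_ ^ k
        linarith
  have := (convex_uIcc y z).norm_image_sub_le_of_norm_hasDerivWithin_le hd hb
    Set.right_mem_uIcc Set.left_mem_uIcc
  rw [← smul_sub, norm_smul] at this
  simpa using this

theorem derivCLM_pow_apply (φ : 𝓢(ℝ, ℂ)) (n : ℕ) (x : ℝ) :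
    ((derivCLM ℂ ℂ) ^ n) φ x = iteratedDeriv n φ x := by
  have : ∀ n, ⇑(((derivCLM ℂ ℂ) ^ n) φ) = iteratedDeriv n φ := fun n => by
    induction n with
    | zero => rfl
    | succ n ih =>
      rw [pow_succ', iteratedDeriv_succ, ← ih]
      rfl
  rw [this]

theorem derivCLM_pow_compSubConstCLM (φ : 𝓢(ℝ, ℂ)) (n : ℕ) (x y : ℝ) :
    ((derivCLM ℂ ℂ) ^ n) (compSubConstCLM ℂ y φ) x = ((derivCLM ℂ ℂ) ^ n) φ (x - y) := by
  rw [derivCLM_pow_apply, derivCLM_pow_apply]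
  exact congrFun (iteratedDeriv_comp_sub_const n φ y) x

theorem continuous_compSubConstCLM (φ : 𝓢(ℝ, ℂ)) :
    Continuous fun y : ℝ => compSubConstCLM ℂ y φ := by
  rw [continuous_iff_continuousAt]
  intro z
  rw [ContinuousAt, (schwartz_withSeminorms ℝ ℝ ℂ).tendsto_nhds]
  rintro ⟨k, n⟩ ε hε
  obtain ⟨C, hC, h⟩ := abs_pow_mul_norm_sub_sub_le (((derivCLM ℂ ℂ) ^ n) φ) k
  have hle : ∀ y : ℝ, schwartzSeminormFamily ℝ ℝ ℂ (k, n)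
      (compSubConstCLM ℂ y φ - compSubConstCLM ℂ z φ) ≤ C * (1 + |y| + |z|) ^ k * |y - z| := by
    intro y
    refine seminorm_le_bound' ℝ k n _ (by positivity) fun x => ?_
    rw [← derivCLM_pow_apply, map_sub, sub_apply, derivCLM_pow_compSubConstCLM,
      derivCLM_pow_compSubConstCLM]
    exact h x y z
  have hc : Continuous fun y : ℝ => C * (1 + |y| + |z|) ^ k * |y - z| := by fun_prop
  have h0 : Tendsto (fun y : ℝ => C * (1 + |y| + |z|) ^ k * |y - z|) (𝓝 z) (𝓝 0) := by
    simpa using hc.tendsto z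
  filter_upwards [h0.eventually_lt_const hε] with y hy
  exact (hle y).trans_lt hy

/-! ### Embedding of the Schwartz space in a Banach space -/

theorem hasTemperateGrowth_ofReal_pow (k : ℕ) :
    Function.HasTemperateGrowth fun x : ℝ => (x : ℂ) ^ k := by
  fun_prop

/-- The map `φ ↦ (x ↦ x ^ k * φ⁽ⁿ⁾ x)_{(k, n) ∈ s}`. -/
def weightedDerivs (s : Finset (ℕ × ℕ)) :
    𝓢(ℝ, ℂ) →L[ℂ] (s → BoundedContinuousFunction ℝ ℂ) :=
  ContinuousLinearMap.pi fun i =>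
    (toBoundedContinuousFunctionCLM ℂ ℝ ℂ).comp
      ((smulLeftCLM ℂ fun x : ℝ => (x : ℂ) ^ i.1.1).comp ((derivCLM ℂ ℂ) ^ i.1.2))

theorem weightedDerivs_apply (s : Finset (ℕ × ℕ)) (φ : 𝓢(ℝ, ℂ)) (i : s) (x : ℝ) :
    weightedDerivs s φ i x = (x : ℂ) ^ i.1.1 * ((derivCLM ℂ ℂ) ^ i.1.2) φ x := by
  simp [weightedDerivs, smulLeftCLM_apply_apply (hasTemperateGrowth_ofReal_pow _)]

/-- Hence a functional bounded by finitely many Schwartz seminorms is bounded by the norm of a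
single Banach space. -/
theorem seminorm_le_norm_weightedDerivs (s : Finset (ℕ × ℕ)) (φ : 𝓢(ℝ, ℂ)) :
    (s.sup (schwartzSeminormFamily ℂ ℝ ℂ)) φ ≤ ‖weightedDerivs s φ‖ := by
  refine Seminorm.finset_sup_apply_le (norm_nonneg _) fun i hi => ?_
  refine seminorm_le_bound' ℂ i.1 i.2 φ (norm_nonneg _) fun x => ?_
  refine le_trans ?_ (norm_le_pi_norm (weightedDerivs s φ) ⟨i, hi⟩)
  refine le_trans ?_ ((weightedDerivs s φ ⟨i, hi⟩).norm_coe_le_norm x)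
  rw [weightedDerivs_apply, derivCLM_pow_apply]
  simp

theorem exists_norm_weightedDerivs_compSubConstCLM_le (s : Finset (ℕ × ℕ)) (φ : 𝓢(ℝ, ℂ)) :
    ∃ (C : ℝ) (N : ℕ), 0 ≤ C ∧
      ∀ y : ℝ, ‖weightedDerivs s (compSubConstCLM ℂ y φ)‖ ≤ C * (1 + |y|) ^ N := by
  choose C hC h using fun i : s => abs_pow_mul_norm_sub_le (((derivCLM ℂ ℂ) ^ i.1.2) φ) i.1.1
  have hS : 0 ≤ ∑ i, C i := Finset.sum_nonneg fun i _ => hC i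
  refine ⟨∑ i, C i, s.sup Prod.fst, hS, fun y => ?_⟩
  refine (pi_norm_le_iff_of_nonneg (by positivity)).2 fun i => ?_
  refine (BoundedContinuousFunction.norm_le (by positivity)).2 fun x => ?_
  rw [weightedDerivs_apply, derivCLM_pow_compSubConstCLM]
  calc ‖(x : ℂ) ^ i.1.1 * ((derivCLM ℂ ℂ) ^ i.1.2) φ (x - y)‖
      = |x| ^ i.1.1 * ‖((derivCLM ℂ ℂ) ^ i.1.2) φ (x - y)‖ := by simp
    _ ≤ C i * (1 + |y|) ^ i.1.1 := h i x y
    _ ≤ _ := by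
      gcongr
      · exact Finset.single_le_sum (f := C) (fun i _ => hC i) (Finset.mem_univ i)
      · linarith [abs_nonneg y]
      · exact Finset.le_sup (f := Prod.fst) i.2

/-! ### Derivatives of convolutions, integrability of polynomial weights -/

theorem convolution_mul_apply (k φ : 𝓢(ℝ, ℂ)) (x : ℝ) :
    convolution (ContinuousLinearMap.mul ℂ ℂ) k φ x = ∫ y, k y * φ (x - y) := by
  rw [convolution_apply]
  rfl

theorem derivCLM_convolution (k φ : 𝓢(ℝ, ℂ)) :
    derivCLM ℂ ℂ (convolution (ContinuousLinearMap.mul ℂ ℂ) k φ) =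
      convolution (ContinuousLinearMap.mul ℂ ℂ) k (derivCLM ℂ ℂ φ) := by
  ext x
  have hd := hasDerivAt_integral_of_dominated_loc_of_deriv_le (μ := volume) (x₀ := x)
    (s := Set.univ) (F := fun x y => k y * φ (x - y)) (F' := fun x y => k y * deriv φ (x - y))
    (bound := fun y => ‖k y‖ * SchwartzMap.seminorm ℝ 0 0 (derivCLM ℂ ℂ φ)) Filter.univ_mem
    (.of_forall fun x => Continuous.aestronglyMeasurable (by fun_prop))
    ?_ (Continuous.aestronglyMeasurable ?_) (.of_forall fun y x _ => ?_)
    (k.integrable.norm.mul_const _) (.of_forall fun y x _ => ?_)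
  · rw [derivCLM_apply, convolution_mul_apply, funext (convolution_mul_apply k φ)]
    exact hd.2.deriv
  · refine (k.integrable.norm.mul_const (SchwartzMap.seminorm ℝ 0 0 φ)).mono'
      (Continuous.aestronglyMeasurable (by fun_prop)) (.of_forall fun y => ?_)
    rw [norm_mul]
    gcongr
    exact norm_le_seminorm ℝ φ _
  · exact k.continuous.mul ((derivCLM ℂ ℂ φ).continuous.comp (by fun_prop))
  · rw [norm_mul]
    gcongr
    exact norm_le_seminorm ℝ (derivCLM ℂ ℂ φ) _
  · exact ((φ.hasDerivAt (x - y)).comp_sub_const x y).const_mul (k y)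

theorem derivCLM_pow_convolution (k φ : 𝓢(ℝ, ℂ)) (n : ℕ) :
    ((derivCLM ℂ ℂ) ^ n) (convolution (ContinuousLinearMap.mul ℂ ℂ) k φ) =
      convolution (ContinuousLinearMap.mul ℂ ℂ) k (((derivCLM ℂ ℂ) ^ n) φ) := by
  induction n generalizing φ with
  | zero => rfl
  | succ n ih =>
    rw [pow_succ]
    change ((derivCLM ℂ ℂ) ^ n) (derivCLM ℂ ℂ _) = _
    rw [derivCLM_convolution, ih]
    rfl

theorem integrable_mul_one_add_abs_pow (k : 𝓢(ℝ, ℂ)) (N : ℕ) :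
    Integrable fun y : ℝ => ‖k y‖ * (1 + |y|) ^ N := by
  refine ((k.integrable.norm.add (k.integrable_pow_mul volume N)).const_mul (2 ^ (N - 1))).mono'
    (Continuous.aestronglyMeasurable (by fun_prop)) (.of_forall fun y => ?_)
  rw [Real.norm_of_nonneg (by positivity)]
  calc ‖k y‖ * (1 + |y|) ^ N ≤ ‖k y‖ * (2 ^ (N - 1) * (1 ^ N + |y| ^ N)) := by
        gcongr
        exact add_pow_le zero_le_one (abs_nonneg y) N
    _ = 2 ^ (N - 1) * (‖k y‖ + ‖y‖ ^ N * ‖k y‖) := by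
        rw [one_pow, Real.norm_eq_abs]
        ring
    _ = _ := rfl

end SchwartzMap

/-! ### Tempered distributions: factorization, growth, pairing with convolutions -/

namespace TemperedDistribution
open SchwartzMap

/-- Continuity bounds `w` by the norm of `weightedDerivs s`, so `w` descends to a bounded functional
on the range, which Hahn–Banach extends. -/
theorem exists_factorization (w : 𝓢'(ℝ, ℂ)) :
    ∃ (s : Finset (ℕ × ℕ)) (Λ : (s → BoundedContinuousFunction ℝ ℂ) →L[ℂ] ℂ),
      ∀ φ, w φ = Λ (weightedDerivs s φ) := by
  let q : Seminorm ℂ 𝓢(ℝ, ℂ) := (normSeminorm ℂ ℂ).comp (w : 𝓢(ℝ, ℂ) →ₗ[ℂ] ℂ)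
  have hq : Continuous q := continuous_norm.comp w.continuous
  obtain ⟨s, C, -, hC⟩ := Seminorm.bound_of_continuous (schwartz_withSeminorms ℂ ℝ ℂ) q hq
  have hb : ∀ φ, ‖w φ‖ ≤ C * ‖weightedDerivs s φ‖ := fun φ =>
    (hC φ).trans (mul_le_mul_of_nonneg_left (seminorm_le_norm_weightedDerivs s φ) C.2)
  let J : 𝓢(ℝ, ℂ) →ₗ[ℂ] (s → BoundedContinuousFunction ℝ ℂ) := (weightedDerivs s).toLinearMap
  -- The section `S` is merely linear. The choice of preimage is harmless, since `w` vanishes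
  -- wherever `J` does (`h3`, `h4`).
  obtain ⟨S, hS⟩ := J.rangeRestrict.exists_rightInverse_of_surjective J.range_rangeRestrict
  have hJS : ∀ v, weightedDerivs s (S v) = v := fun v =>
    congrArg Subtype.val (LinearMap.congr_fun hS v)
  let f : StrongDual ℂ (LinearMap.range J) :=
    ((w : 𝓢(ℝ, ℂ) →ₗ[ℂ] ℂ).comp S).mkContinuous C fun v => by
      have := hb (S v)
      rwa [hJS] at this
  obtain ⟨Λ, hΛ, -⟩ := exists_extension_norm_eq _ f
  refine ⟨s, Λ, fun φ => ?_⟩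
  have h1 := hΛ ⟨J φ, LinearMap.mem_range_self J φ⟩
  have h2 : f ⟨J φ, LinearMap.mem_range_self J φ⟩ = w (S ⟨J φ, LinearMap.mem_range_self J φ⟩) := rfl
  have h3 := hb (φ - S ⟨J φ, LinearMap.mem_range_self J φ⟩)
  rw [map_sub, map_sub, hJS] at h3
  have h4 : w φ - w (S ⟨J φ, LinearMap.mem_range_self J φ⟩) = 0 := by
    simpa [J] using h3
  rw [sub_eq_zero.1 h4, ← h2, ← h1]
  rfl

theorem continuous_apply_compSubConstCLM (w : 𝓢'(ℝ, ℂ)) (φ : 𝓢(ℝ, ℂ)) :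
    Continuous fun y : ℝ => w (compSubConstCLM ℂ y φ) :=
  w.continuous.comp (continuous_compSubConstCLM φ)

theorem exists_norm_apply_compSubConstCLM_le (w : 𝓢'(ℝ, ℂ)) (φ : 𝓢(ℝ, ℂ)) :
    ∃ (C : ℝ) (N : ℕ), 0 ≤ C ∧ ∀ y : ℝ, ‖w (compSubConstCLM ℂ y φ)‖ ≤ C * (1 + |y|) ^ N := by
  obtain ⟨s, Λ, h⟩ := exists_factorization w
  obtain ⟨C, N, hC, hb⟩ := exists_norm_weightedDerivs_compSubConstCLM_le s φ
  refine ⟨‖Λ‖ * C, N, by positivity, fun y => ?_⟩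
  rw [h, mul_assoc]
  exact (Λ.le_opNorm _).trans (by gcongr; exact hb y)

/-- After factorization the convolution is a Bochner integral of translates in a Banach space, as
evaluation at each point shows; `Λ` then passes under the integral. -/
theorem apply_convolution (w : 𝓢'(ℝ, ℂ)) (k φ : 𝓢(ℝ, ℂ)) :
    w (convolution (ContinuousLinearMap.mul ℂ ℂ) k φ) =
      ∫ y, k y * w (compSubConstCLM ℂ y φ) := by
  obtain ⟨s, Λ, h⟩ := exists_factorization w
  obtain ⟨C, N, hC, hb⟩ := exists_norm_weightedDerivs_compSubConstCLM_le s φ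
  have hint : Integrable fun y => k y • weightedDerivs s (compSubConstCLM ℂ y φ) := by
    refine ((integrable_mul_one_add_abs_pow k N).const_mul C).mono' ?_ (.of_forall fun y => ?_)
    -- Bounded continuous functions are not separable; strong measurability comes from second
    -- countability of the domain `ℝ`.
    · have : SecondCountableTopologyEither ℝ (s → BoundedContinuousFunction ℝ ℂ) :=
        secondCountableTopologyEither_of_left _ _
      exact (k.continuous.smul ((weightedDerivs s).continuous.comp
        (continuous_compSubConstCLM φ))).aestronglyMeasurable
    · rw [norm_smul]
      calc _ ≤ ‖k y‖ * (C * (1 + |y|) ^ N) := by gcongr; exact hb y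
        _ = _ := by ring
  have key : weightedDerivs s (convolution (ContinuousLinearMap.mul ℂ ℂ) k φ) =
      ∫ y, k y • weightedDerivs s (compSubConstCLM ℂ y φ) := by
    ext i x
    let e : (s → BoundedContinuousFunction ℝ ℂ) →L[ℂ] ℂ :=
      (BoundedContinuousFunction.evalCLM ℂ x).comp (ContinuousLinearMap.proj i)
    have he : ∀ v, e v = v i x := fun v => rfl
    rw [← he (∫ y, k y • weightedDerivs s (compSubConstCLM ℂ y φ)), ← e.integral_comp_comm hint]
    rw [weightedDerivs_apply, derivCLM_pow_convolution, convolution_mul_apply,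
      ← integral_const_mul]
    congr 1 with y
    rw [map_smul, he, weightedDerivs_apply, derivCLM_pow_compSubConstCLM, smul_eq_mul]
    ring
  rw [h, key, ← Λ.integral_comp_comm hint]
  simp [h]

end TemperedDistribution

namespace OperatorPW
open SchwartzMap

/-! ### Products of multiplication operators and Fourier multipliers -/

/-- Multiplication by a Schwartz function on `L²(ℝ)`. -/
def mulL2 (m : 𝓢(ℝ, ℂ)) : L2R →L[ℂ] L2R :=
  (ContinuousLinearMap.lsmul ℂ ℂ).holderL volume ∞ 2 2 (m.toLp ∞)

theorem toTemperedDistribution_mulL2 (m g : 𝓢(ℝ, ℂ)) (f : L2R) :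
    Lp.toTemperedDistribution (mulL2 m f) g =
      Lp.toTemperedDistribution f (smulLeftCLM ℂ m g) := by
  simp only [Lp.toTemperedDistribution_apply]
  refine integral_congr_ae ?_
  filter_upwards [(ContinuousLinearMap.lsmul ℂ ℂ).coeFn_holder (r := 2) (m.toLp ∞) f,
    m.coeFn_toLp ∞] with x h1 h2
  have h3 : (mulL2 m f : ℝ → ℂ) x = m x * f x := by
    rw [← h2]
    exact h1
  rw [h3, smulLeftCLM_apply_apply m.hasTemperateGrowth]
  simp only [smul_eq_mul]
  ring

theorem toTemperedDistribution_fourier (f : L2R) (g : 𝓢(ℝ, ℂ)) :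
    Lp.toTemperedDistribution (𝓕 f) g = Lp.toTemperedDistribution f (𝓕 g) := by
  rw [← MeasureTheory.Lp.fourier_toTemperedDistribution_eq, TemperedDistribution.fourier_apply]

theorem toTemperedDistribution_fourierInv (f : L2R) (g : 𝓢(ℝ, ℂ)) :
    Lp.toTemperedDistribution (𝓕⁻ f) g = Lp.toTemperedDistribution f (𝓕⁻ g) := by
  rw [← MeasureTheory.Lp.fourierInv_toTemperedDistribution_eq,
    TemperedDistribution.fourierInv_apply]

/-- The Fourier multiplier with Schwartz symbol `α`, followed by multiplication by `m`. -/
def mulMultiplier (m α : 𝓢(ℝ, ℂ)) : L2R →L[ℂ] L2R :=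
  mulL2 m ∘L FourierTransform.fourierInvCLM ℂ L2R ∘L mulL2 α ∘L FourierTransform.fourierCLM ℂ L2R

/-- Multiplication by `m`, followed by the Fourier multiplier with Schwartz symbol `α`. -/
def multiplierMul (m α : 𝓢(ℝ, ℂ)) : L2R →L[ℂ] L2R :=
  FourierTransform.fourierInvCLM ℂ L2R ∘L mulL2 α ∘L FourierTransform.fourierCLM ℂ L2R ∘L mulL2 m

/-- The transpose of `mulMultiplier m α` on Schwartz functions. -/
def mulMultiplierTranspose (m α g : 𝓢(ℝ, ℂ)) : 𝓢(ℝ, ℂ) :=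
  𝓕 (smulLeftCLM ℂ α (𝓕⁻ (smulLeftCLM ℂ m g)))

/-- The transpose of `multiplierMul m α` on Schwartz functions. -/
def multiplierMulTranspose (m α g : 𝓢(ℝ, ℂ)) : 𝓢(ℝ, ℂ) :=
  smulLeftCLM ℂ m (𝓕 (smulLeftCLM ℂ α (𝓕⁻ g)))

theorem toTemperedDistribution_mulMultiplier (m α g : 𝓢(ℝ, ℂ)) (f : L2R) :
    Lp.toTemperedDistribution (mulMultiplier m α f) g =
      Lp.toTemperedDistribution f (mulMultiplierTranspose m α g) := by
  change Lp.toTemperedDistribution (mulL2 m (𝓕⁻ (mulL2 α (𝓕 f)))) g = _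
  rw [toTemperedDistribution_mulL2, toTemperedDistribution_fourierInv,
    toTemperedDistribution_mulL2, toTemperedDistribution_fourier]
  rfl

theorem toTemperedDistribution_multiplierMul (m α g : 𝓢(ℝ, ℂ)) (f : L2R) :
    Lp.toTemperedDistribution (multiplierMul m α f) g =
      Lp.toTemperedDistribution f (multiplierMulTranspose m α g) := by
  change Lp.toTemperedDistribution (𝓕⁻ (mulL2 α (𝓕 (mulL2 m f)))) g = _
  rw [toTemperedDistribution_fourierInv, toTemperedDistribution_mulL2,
    toTemperedDistribution_fourier, toTemperedDistribution_mulL2]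
  rfl

theorem toTemperedDistribution_toLp {E : Type*} [NormedAddCommGroup E] [NormedSpace ℝ E]
    [MeasurableSpace E] [BorelSpace E] [SecondCountableTopology E] {μ : Measure E}
    [μ.HasTemperateGrowth] (f g : 𝓢(E, ℂ)) :
    Lp.toTemperedDistribution (f.toLp 2 μ) g = ∫ x, g x * f x ∂μ := by
  rw [Lp.toTemperedDistribution_apply]
  refine integral_congr_ae ?_
  filter_upwards [f.coeFn_toLp 2 μ] with x h
  rw [h, smul_eq_mul]

/-! ### Integration over the plane -/

/-- The measurable equivalence between the plane and `ℝ × ℝ`. -/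
def planeEquiv : Plane ≃ᵐ ℝ × ℝ :=
  (MeasurableEquiv.toLp 2 (Fin 2 → ℝ)).symm.trans MeasurableEquiv.finTwoArrow

theorem measurePreserving_planeEquiv : MeasurePreserving planeEquiv volume volume :=
  (volume_preserving_finTwoArrow ℝ).comp
    (EuclideanSpace.volume_preserving_symm_measurableEquiv_toLp (Fin 2))

theorem integral_plane (f : ℝ → ℝ → ℂ) :
    ∫ z : Plane, f (z 0) (z 1) = ∫ p : ℝ × ℝ, f p.1 p.2 :=
  measurePreserving_planeEquiv.integral_comp' (g := fun p : ℝ × ℝ => f p.1 p.2)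

theorem integrable_plane_iff (f : ℝ → ℝ → ℂ) :
    Integrable (fun z : Plane => f (z 0) (z 1)) ↔ Integrable fun p : ℝ × ℝ => f p.1 p.2 :=
  measurePreserving_planeEquiv.integrable_comp_emb planeEquiv.measurableEmbedding
    (g := fun p : ℝ × ℝ => f p.1 p.2)

theorem measurePreserving_rot : MeasurePreserving rot volume volume := by
  have h : ∀ z, ‖rot z‖ = ‖z‖ := fun z => by
    simp [rot, EuclideanSpace.norm_eq, Fin.sum_univ_two, add_comm]
  exact (LinearIsometryEquiv.mk rot.toLinearEquiv h).measurePreserving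

/-! ### Operators with a Schwartz spreading function -/

/-- The Kohn-Nirenberg symbol of the operator with spreading function `η`. -/
def symbolOfSpreading (η : 𝓢(Plane, ℂ)) : 𝓢(Plane, ℂ) :=
  compCLMOfContinuousLinearEquiv ℂ rot (𝓕⁻ η)

theorem symbolOfSpreading_apply (η : 𝓢(Plane, ℂ)) (z : Plane) :
    symbolOfSpreading η z =
      ∫ v : Plane, Complex.exp (2 * Real.pi * Complex.I * (z 0 * v 1 - v 0 * z 1)) * η v := by
  change (𝓕⁻ η) (rot z) = _
  rw [SchwartzMap.fourierInv_coe, Real.fourierInv_eq']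
  refine integral_congr_ae (Filter.Eventually.of_forall fun v => ?_)
  have : inner ℝ v (rot z) = z 0 * v 1 - v 0 * z 1 := by
    simp [rot, PiLp.inner_apply, Fin.sum_univ_two]
    ring
  simp only [this, smul_eq_mul]
  congr 2
  push_cast
  ring

theorem sympFourier_apply (σ : 𝓢'(Plane, ℂ)) (ψ : 𝓢(Plane, ℂ)) :
    sympFourier σ ψ = σ (sympFourierTest ψ) := rfl

/-- Both transforms carry the same measure-preserving rotation, which drops out; moving `𝓕` from `ψ`
onto `𝓕⁻ η` recovers `η`. -/
theorem sympFourier_symbolOfSpreading (η ψ : 𝓢(Plane, ℂ)) :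
    sympFourier (Lp.toTemperedDistribution ((symbolOfSpreading η).toLp 2)) ψ =
      ∫ z, ψ z * η z := by
  rw [sympFourier_apply, toTemperedDistribution_toLp]
  have h1 : ∀ z, sympFourierTest ψ z * symbolOfSpreading η z = (𝓕 ψ * 𝓕⁻ η : Plane → ℂ) (rot z) :=
    fun z => rfl
  rw [integral_congr_ae (.of_forall h1),
    measurePreserving_rot.integral_comp rot.toHomeomorph.measurableEmbedding]
  simp only [Pi.mul_apply]
  rw [integral_fourier_mul_eq, FourierTransform.fourier_fourierInv_eq]

theorem dsupport_sympFourier_symbolOfSpreading_subset {M : Set Plane} (hM : IsClosed M)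
    {η : 𝓢(Plane, ℂ)} (hη : ∀ z ∉ M, η z = 0) :
    Distribution.dsupport
      (sympFourier (Lp.toTemperedDistribution ((symbolOfSpreading η).toLp 2))) ⊆ M := by
  refine Set.sInter_subset_of_mem ⟨fun ψ hψ => ?_, hM⟩
  rw [sympFourier_symbolOfSpreading]
  refine integral_eq_zero_of_ae (.of_forall fun z => ?_)
  by_cases hz : z ∈ M
  · have : ψ z = 0 := by
      by_contra h
      exact hψ (subset_tsupport _ h) hz
    simp [this]
  · simp [hη z hz]

theorem isClosed_rectangle (T Ω : ℝ) : IsClosed (rectangle T Ω) := by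
  have h0 : Continuous fun z : Plane => z 0 := by fun_prop
  have h1 : Continuous fun z : Plane => z 1 := by fun_prop
  exact (isClosed_Icc.preimage h0).inter (isClosed_Icc.preimage h1)

theorem fourierInv_apply_eq_integral (f : 𝓢(ℝ, ℂ)) (x : ℝ) :
    𝓕⁻ f x = ∫ t : ℝ, Complex.exp (2 * Real.pi * Complex.I * (x * t)) * f t := by
  rw [SchwartzMap.fourierInv_coe, Real.fourierInv_eq']
  congr 1 with t
  simp only [smul_eq_mul, RCLike.inner_apply, conj_trivial]
  congr 2
  push_cast
  ring

theorem fourier_apply_eq_integral (f : 𝓢(ℝ, ℂ)) (x : ℝ) :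
    𝓕 f x = ∫ t : ℝ, Complex.exp (-(2 * Real.pi * Complex.I * (x * t))) * f t := by
  rw [SchwartzMap.fourier_coe, Real.fourier_eq']
  congr 1 with t
  simp only [smul_eq_mul, RCLike.inner_apply, conj_trivial]
  congr 2
  push_cast
  ring

theorem symbolOfSpreading_tensor (a b : 𝓢(ℝ, ℂ)) (z : Plane) :
    symbolOfSpreading (tensor a b) z = 𝓕⁻ b (z 0) * 𝓕 a (z 1) := by
  rw [symbolOfSpreading_apply, fourierInv_apply_eq_integral, fourier_apply_eq_integral,
    mul_comm (∫ _, _), ← integral_prod_mul]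
  refine (integral_plane fun t γ => Complex.exp (2 * Real.pi * Complex.I *
    (z 0 * γ - t * z 1)) * (a t * b γ)).trans (integral_congr_ae (.of_forall fun p => ?_))
  dsimp only
  rw [mul_sub, sub_eq_neg_add, Complex.exp_add, mul_comm (z 1 : ℂ)]
  ring

theorem integrable_knTest_mul (f g : 𝓢(ℝ, ℂ)) (s : 𝓢(Plane, ℂ)) :
    Integrable fun z => knTest f g z * s z := by
  refine ((smulLeftCLM ℂ (knTest f g) s).integrable (μ := volume)).congr (.of_forall fun z => ?_)
  rw [smulLeftCLM_apply_apply (knTest f g).hasTemperateGrowth, smul_eq_mul]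

theorem chirp_eq (z : Plane) : chirp z = Complex.exp (2 * Real.pi * Complex.I * (z 0 * z 1)) := by
  rw [chirp]
  congr 1
  push_cast
  ring

/-- Since multiplication acts last, the symbol is simply `m(x) α(ξ)`, and its spreading function is
a pure tensor. -/
theorem isKNSymbol_mulMultiplier (m α : 𝓢(ℝ, ℂ)) :
    IsKNSymbol (mulMultiplier m α)
      (Lp.toTemperedDistribution ((symbolOfSpreading (tensor (𝓕⁻ α) (𝓕 m))).toLp 2)) := by
  intro f g
  let k : ℝ → ℝ → ℂ := fun x ξ => Complex.exp (2 * Real.pi * Complex.I * (x * ξ)) *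
    (g x * 𝓕 f ξ) * (m x * α ξ)
  have hk : ∀ z, knTest f g z * symbolOfSpreading (tensor (𝓕⁻ α) (𝓕 m)) z = k (z 0) (z 1) :=
    fun z => by
      rw [symbolOfSpreading_tensor, knTest_apply, chirp_eq, FourierTransform.fourier_fourierInv_eq,
        FourierTransform.fourierInv_fourier_eq]
  have hki : Integrable fun p : ℝ × ℝ => k p.1 p.2 := by
    rw [← integrable_plane_iff]
    exact (integrable_knTest_mul f g _).congr (.of_forall hk)
  rw [toTemperedDistribution_mulMultiplier, toTemperedDistribution_toLp,
    toTemperedDistribution_toLp, integral_congr_ae (.of_forall hk), integral_plane,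
    Measure.volume_eq_prod, integral_prod_symm _ hki]
  rw [mulMultiplierTranspose, integral_fourier_mul_eq]
  congr 1 with ξ
  rw [smulLeftCLM_apply_apply α.hasTemperateGrowth, fourierInv_apply_eq_integral, smul_eq_mul,
    mul_right_comm, ← integral_const_mul]
  congr 1 with x
  rw [smulLeftCLM_apply_apply m.hasTemperateGrowth, smul_eq_mul]
  simp only [k]
  rw [mul_comm (x : ℂ)]
  ring

/-- The function `(t, γ) ↦ e^{-2πi t γ} a t * b γ`. -/
def twistedTensor (a b : 𝓢(ℝ, ℂ)) : 𝓢(Plane, ℂ) :=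
  smulLeftCLM ℂ (fun z => starRingEnd ℂ (chirp z)) (tensor a b)

theorem conj_chirp_hasTemperateGrowth :
    (fun z => starRingEnd ℂ (chirp z)).HasTemperateGrowth :=
  (Complex.conjCLE : ℂ →L[ℝ] ℂ).hasTemperateGrowth.comp chirp_hasTemperateGrowth

theorem twistedTensor_apply (a b : 𝓢(ℝ, ℂ)) (z : Plane) :
    twistedTensor a b z = starRingEnd ℂ (chirp z) * (a (z 0) * b (z 1)) := by
  simp [twistedTensor, smulLeftCLM_apply_apply conj_chirp_hasTemperateGrowth]

theorem symbolOfSpreading_twistedTensor (a b : 𝓢(ℝ, ℂ)) (z : Plane) :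
    symbolOfSpreading (twistedTensor a b) z =
      ∫ t : ℝ, Complex.exp (-(2 * Real.pi * Complex.I * (t * z 1))) * a t * 𝓕⁻ b (z 0 - t) := by
  let k : ℝ → ℝ → ℂ := fun t γ => Complex.exp (2 * Real.pi * Complex.I *
    (z 0 * γ - t * z 1)) * (Complex.exp (-(2 * Real.pi * Complex.I * (t * γ))) * (a t * b γ))
  have hk : ∀ v : Plane, Complex.exp (2 * Real.pi * Complex.I * (z 0 * v 1 - v 0 * z 1)) *
      twistedTensor a b v = k (v 0) (v 1) := fun v => by
    rw [twistedTensor_apply, chirp_eq, ← Complex.exp_conj]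
    simp [k, map_ofNat]
  have hki : Integrable fun p : ℝ × ℝ => k p.1 p.2 := by
    refine (a.integrable.mul_prod b.integrable).mono
      (Continuous.aestronglyMeasurable (by fun_prop)) (.of_forall fun p => ?_)
    simp [k, Complex.norm_exp]
  rw [symbolOfSpreading_apply, integral_congr_ae (.of_forall hk), integral_plane,
    Measure.volume_eq_prod, integral_prod _ hki]
  congr 1 with t
  rw [fourierInv_apply_eq_integral, ← integral_const_mul]
  congr 1 with γ
  have : Complex.exp (2 * Real.pi * Complex.I * (z 0 * γ - t * z 1)) *
      Complex.exp (-(2 * Real.pi * Complex.I * (t * γ))) =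
      Complex.exp (-(2 * Real.pi * Complex.I * (t * z 1))) *
      Complex.exp (2 * Real.pi * Complex.I * ((z 0 - t : ℝ) * γ)) := by
    rw [← Complex.exp_add, ← Complex.exp_add]
    congr 1
    push_cast
    ring
  simp only [k]
  rw [← mul_assoc, this]
  ring

/-- Exchanging the two factors exchanges time and frequency shifts, which costs the phase `e^{-2πi t
γ}` in the spreading function and leaves its zero set alone. -/
theorem isKNSymbol_multiplierMul (m α : 𝓢(ℝ, ℂ)) :
    IsKNSymbol (multiplierMul m α)
      (Lp.toTemperedDistribution ((symbolOfSpreading (twistedTensor (𝓕⁻ α) (𝓕 m))).toLp 2)) := by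
  intro f g
  set a := 𝓕⁻ α with ha
  let k : ℝ → ℝ → ℂ := fun x ξ => Complex.exp (2 * Real.pi * Complex.I * (x * ξ)) *
    (g x * 𝓕 f ξ) * ∫ t : ℝ, Complex.exp (-(2 * Real.pi * Complex.I * (t * ξ))) * a t * m (x - t)
  have hk : ∀ z, knTest f g z * symbolOfSpreading (twistedTensor a (𝓕 m)) z = k (z 0) (z 1) :=
    fun z => by
      rw [symbolOfSpreading_twistedTensor, knTest_apply, chirp_eq,
        FourierTransform.fourierInv_fourier_eq]
  have hki : Integrable fun p : ℝ × ℝ => k p.1 p.2 := by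
    rw [← integrable_plane_iff]
    exact (integrable_knTest_mul f g _).congr (.of_forall hk)
  -- Fubini puts the `ξ`-integral inside, where Fourier inversion yields `f (x - t)`; what remains
  -- is the convolution of `𝓕⁻ α` with `m f`.
  have hinner : ∀ x, ∫ ξ, k x ξ =
      g x * convolution (ContinuousLinearMap.mul ℂ ℂ) a (smulLeftCLM ℂ m f) x := fun x => by
    have hsi : Integrable (fun p : ℝ × ℝ => 𝓕 f p.1 * a p.2 * (Complex.exp (2 * Real.pi *
        Complex.I * ((x - p.2 : ℝ) * p.1)) * m (x - p.2))) (volume.prod volume) := by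
      refine Integrable.mul_bdd (c := SchwartzMap.seminorm ℝ 0 0 m)
        ((𝓕 f).integrable.mul_prod a.integrable) (Continuous.aestronglyMeasurable (by fun_prop))
        (.of_forall fun p => ?_)
      rw [norm_mul, Complex.norm_exp]
      simpa using norm_le_seminorm ℝ m (x - p.2)
    calc ∫ ξ, k x ξ = g x * ∫ ξ, ∫ t, 𝓕 f ξ * a t * (Complex.exp (2 * Real.pi *
          Complex.I * ((x - t : ℝ) * ξ)) * m (x - t)) := by
          rw [← integral_const_mul]
          congr 1 with ξ
          simp only [k]
          rw [← integral_const_mul, ← integral_const_mul]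
          congr 1 with t
          have : Complex.exp (2 * Real.pi * Complex.I * ((x - t : ℝ) * ξ)) =
              Complex.exp (2 * Real.pi * Complex.I * (x * ξ)) *
              Complex.exp (-(2 * Real.pi * Complex.I * (t * ξ))) := by
            rw [← Complex.exp_add]
            congr 1
            push_cast
            ring
          rw [this]
          ring
      _ = g x * ∫ t, ∫ ξ, 𝓕 f ξ * a t * (Complex.exp (2 * Real.pi *
          Complex.I * ((x - t : ℝ) * ξ)) * m (x - t)) := by rw [integral_integral_swap hsi]
      _ = _ := by
          rw [convolution_mul_apply]
          congr 2 with t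
          have hf : f (x - t) = 𝓕⁻ (𝓕 f) (x - t) := by
            rw [FourierTransform.fourierInv_fourier_eq]
          rw [smulLeftCLM_apply_apply m.hasTemperateGrowth, hf,
            fourierInv_apply_eq_integral (𝓕 f), smul_eq_mul, ← mul_assoc, ← integral_const_mul]
          congr 1 with ξ
          ring
  have hconv : convolution (ContinuousLinearMap.mul ℂ ℂ) a (smulLeftCLM ℂ m f) =
      𝓕⁻ (smulLeftCLM ℂ α (𝓕 (smulLeftCLM ℂ m f))) := by
    apply (FourierTransform.fourierEquiv ℂ 𝓢(ℝ, ℂ)).injective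
    ext ξ
    simp [fourier_convolution, ha, smulLeftCLM_apply_apply α.hasTemperateGrowth]
  rw [toTemperedDistribution_multiplierMul, toTemperedDistribution_toLp,
    toTemperedDistribution_toLp, integral_congr_ae (.of_forall hk), integral_plane,
    Measure.volume_eq_prod, integral_prod _ hki]
  simp only [hinner]
  rw [hconv, ← integral_fourierInv_mul_eq]
  calc ∫ x, multiplierMulTranspose m α g x * f x
      = ∫ x, 𝓕 (smulLeftCLM ℂ α (𝓕⁻ g)) x * smulLeftCLM ℂ m f x := by
        congr 1 with x
        simp only [multiplierMulTranspose, smulLeftCLM_apply_apply m.hasTemperateGrowth,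
          smul_eq_mul]
        ring
    _ = _ := by
        rw [integral_fourier_mul_eq]
        congr 1 with x
        simp only [smulLeftCLM_apply_apply α.hasTemperateGrowth, smul_eq_mul]
        ring

theorem mulMultiplier_mem_OPW {T Ω : ℝ} {m α : 𝓢(ℝ, ℂ)}
    (hα : ∀ t ∉ Set.Icc 0 T, 𝓕⁻ α t = 0) (hm : ∀ γ ∉ Set.Icc (-Ω / 2) (Ω / 2), 𝓕 m γ = 0) :
    mulMultiplier m α ∈ OPW (rectangle T Ω) := by
  refine ⟨_, isKNSymbol_mulMultiplier m α,
    dsupport_sympFourier_symbolOfSpreading_subset (isClosed_rectangle T Ω) fun z hz => ?_⟩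
  rw [tensor_apply]
  rcases not_and_or.1 hz with h | h
  · rw [hα _ h, zero_mul]
  · rw [hm _ h, mul_zero]

theorem multiplierMul_mem_OPW {T Ω : ℝ} {m α : 𝓢(ℝ, ℂ)}
    (hα : ∀ t ∉ Set.Icc 0 T, 𝓕⁻ α t = 0) (hm : ∀ γ ∉ Set.Icc (-Ω / 2) (Ω / 2), 𝓕 m γ = 0) :
    multiplierMul m α ∈ OPW (rectangle T Ω) := by
  refine ⟨_, isKNSymbol_multiplierMul m α,
    dsupport_sympFourier_symbolOfSpreading_subset (isClosed_rectangle T Ω) fun z hz => ?_⟩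
  rw [twistedTensor_apply]
  rcases not_and_or.1 hz with h | h
  · rw [hα _ h, zero_mul, mul_zero]
  · rw [hm _ h, mul_zero, mul_zero]

/-! ### Norms in `L²` -/

theorem norm_toTemperedDistribution_le {E : Type*} [NormedAddCommGroup E] [NormedSpace ℝ E]
    [MeasurableSpace E] [BorelSpace E] [SecondCountableTopology E] {μ : Measure E}
    [μ.HasTemperateGrowth] (f : Lp ℂ 2 μ) (g : 𝓢(E, ℂ)) :
    ‖Lp.toTemperedDistribution f g‖ ≤ ‖f‖ * ‖g.toLp 2 μ‖ := by
  let B := ContinuousLinearMap.mul ℂ ℂ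
  have h : Lp.toTemperedDistribution f g = ∫ x, (B.holder 1 f (g.toLp 2 μ) : E → ℂ) x ∂μ := by
    rw [Lp.toTemperedDistribution_apply]
    refine integral_congr_ae ?_
    filter_upwards [B.coeFn_holder (r := 1) f (g.toLp 2 μ), g.coeFn_toLp 2 μ] with x h1 h2
    rw [h1, h2, smul_eq_mul, mul_comm]
    rfl
  rw [h]
  refine (norm_integral_le_integral_norm _).trans ?_
  rw [← L1.norm_eq_integral_norm]
  refine (B.norm_holder_apply_apply_le f (g.toLp 2 μ)).trans ?_
  rw [mul_assoc]
  exact mul_le_of_le_one_left (by positivity) (ContinuousLinearMap.opNorm_mul_le ℂ ℂ)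

theorem norm_toLp_two_eq {E : Type*} [NormedAddCommGroup E] [NormedSpace ℝ E]
    [MeasurableSpace E] [BorelSpace E] [SecondCountableTopology E] {μ : Measure E}
    [μ.HasTemperateGrowth] (f : 𝓢(E, ℂ)) :
    ‖f.toLp 2 μ‖ = (∫ x, ‖f x‖ ^ (2 : ℝ) ∂μ) ^ (1 / 2 : ℝ) := by
  rw [norm_toLp' (by norm_num) (by norm_num)]
  norm_num

theorem norm_toLp_compSubConstCLM (f : 𝓢(ℝ, ℂ)) (x : ℝ) :
    ‖(compSubConstCLM ℂ x f).toLp 2 volume‖ = ‖f.toLp 2 volume‖ := by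
  rw [norm_toLp_two_eq, norm_toLp_two_eq]
  simp only [compSubConstCLM_apply]
  rw [integral_sub_right_eq_self fun y => ‖f y‖ ^ (2 : ℝ)]

theorem norm_toLp_fourier (f : 𝓢(ℝ, ℂ)) : ‖(𝓕 f).toLp 2 volume‖ = ‖f.toLp 2 volume‖ :=
  norm_fourier_toL2_eq f

theorem norm_toLp_fourierInv (f : 𝓢(ℝ, ℂ)) : ‖(𝓕⁻ f).toLp 2 volume‖ = ‖f.toLp 2 volume‖ := by
  rw [← norm_toLp_fourier, FourierTransform.fourier_fourierInv_eq]

/-- The chirp is unimodular, so this is Fubini and Plancherel. By Cauchy–Schwarz, the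
Hilbert–Schmidt norm then dominates matrix coefficients. -/
theorem norm_toLp_knTest (f g : 𝓢(ℝ, ℂ)) :
    ‖(knTest f g).toLp 2 volume‖ = ‖f.toLp 2 volume‖ * ‖g.toLp 2 volume‖ := by
  have hk : ∀ z, ‖knTest f g z‖ ^ (2 : ℝ) = ‖g (z 0)‖ ^ (2 : ℝ) * ‖𝓕 f (z 1)‖ ^ (2 : ℝ) :=
    fun z => by
      rw [knTest_apply, norm_mul, norm_mul, chirp, Complex.norm_exp_ofReal_mul_I, one_mul,
        Real.mul_rpow (norm_nonneg _) (norm_nonneg _)]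
  have hint : ∫ z, ‖knTest f g z‖ ^ (2 : ℝ) =
      (∫ x, ‖g x‖ ^ (2 : ℝ)) * ∫ ξ, ‖𝓕 f ξ‖ ^ (2 : ℝ) := by
    rw [integral_congr_ae (.of_forall hk), ← integral_prod_mul]
    exact measurePreserving_planeEquiv.integral_comp'
      (g := fun p : ℝ × ℝ => ‖g p.1‖ ^ (2 : ℝ) * ‖𝓕 f p.2‖ ^ (2 : ℝ))
  rw [norm_toLp_two_eq, hint, Real.mul_rpow (integral_nonneg fun _ => by positivity)
    (integral_nonneg fun _ => by positivity), ← norm_toLp_two_eq, ← norm_toLp_two_eq,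
    norm_toLp_fourier, mul_comm]

theorem norm_sq_eq_integral (u : L2R) : ‖u‖ ^ 2 = ∫ x, ‖(u : ℝ → ℂ) x‖ ^ 2 := by
  have h := L2.inner_def (𝕜 := ℂ) u u
  rw [inner_self_eq_norm_sq_to_K] at h
  have h2 : ∀ x, inner ℂ ((u : ℝ → ℂ) x) ((u : ℝ → ℂ) x) = ((‖(u : ℝ → ℂ) x‖ ^ 2 : ℝ) : ℂ) :=
    fun x => by rw [inner_self_eq_norm_sq_to_K]; simp
  simp only [h2] at h
  rw [integral_complex_ofReal] at h
  exact Complex.ofReal_injective (by rw [← h, Complex.ofReal_pow]; rfl)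

theorem eq_of_toTemperedDistribution_eq {u v : L2R}
    (h : ∀ g, Lp.toTemperedDistribution u g = Lp.toTemperedDistribution v g) : u = v := by
  have hker := Lp.ker_toTemperedDistributionCLM_eq_bot (F := ℂ) (μ := (volume : Measure ℝ)) (p := 2)
  refine LinearMap.ker_eq_bot.1 hker ?_
  ext g
  exact h g

theorem exists_integral_mul_ne_zero {ψ : 𝓢(ℝ, ℂ)} (hψ : ψ ≠ 0) :
    ∃ f : 𝓢(ℝ, ℂ), ∫ x, f x * ψ x ≠ 0 := by
  by_contra! h
  refine hψ (injective_toLp 2 volume (eq_of_toTemperedDistribution_eq fun g => ?_))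
  rw [toTemperedDistribution_toLp, toTemperedDistribution_toLp, h g]
  simp

/-! ### Consequences of identification -/

/-- Both notions of identification bound the `L²` norm of the response from below by the matrix
coefficients of the operator. -/
theorem exists_lower_bound_of_identifies {w : 𝓢'(ℝ, ℂ)} {M : Set Plane}
    (hw : Identifies w M ∨ IdentifiesHilbertSchmidt w M) :
    ∃ A : ℝ, 0 < A ∧ ∀ H ∈ OPW M, ∀ s : L2Plane, IsKNSymbol H (Lp.toTemperedDistribution s) →
      ∃ u : L2R, IsResponse H w u ∧ ∀ f g : 𝓢(ℝ, ℂ),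
        A * ‖Lp.toTemperedDistribution (H (f.toLp 2)) g‖ ≤
          ‖u‖ * (‖f.toLp 2 volume‖ * ‖g.toLp 2 volume‖) := by
  rcases hw with ⟨A, B, hA, -, h⟩ | ⟨A, B, hA, -, h⟩
  · refine ⟨A, hA, fun H hH s _ => ?_⟩
    obtain ⟨u, hu, hlow, -⟩ := h H hH
    refine ⟨u, hu, fun f g => ?_⟩
    have h1 := norm_toTemperedDistribution_le (H (f.toLp 2 volume)) g
    have h2 := H.le_opNorm (f.toLp 2 volume)
    have h3 := mul_le_mul_of_nonneg_right h2 (norm_nonneg (g.toLp 2 volume))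
    have h4 := mul_le_mul_of_nonneg_left (h1.trans h3) hA.le
    have h5 := mul_le_mul_of_nonneg_right hlow
      (mul_nonneg (norm_nonneg (f.toLp 2 volume)) (norm_nonneg (g.toLp 2 volume)))
    refine h4.trans (le_trans (le_of_eq ?_) h5)
    ring
  · refine ⟨A, hA, fun H hH s hs => ?_⟩
    obtain ⟨u, hu, hlow, -⟩ := h H hH s hs
    refine ⟨u, hu, fun f g => ?_⟩
    have h1 := norm_toTemperedDistribution_le s (knTest f g)
    rw [norm_toLp_knTest] at h1
    have h4 := mul_le_mul_of_nonneg_left h1 hA.le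
    have h5 := mul_le_mul_of_nonneg_right hlow
      (mul_nonneg (norm_nonneg (f.toLp 2 volume)) (norm_nonneg (g.toLp 2 volume)))
    rw [hs f g]
    refine h4.trans (le_trans (le_of_eq ?_) h5)
    ring

/-- The transpose is unique, as its values are determined by their pairings with `L²`; so an
explicit formula may replace the one supplied by `IsResponse`. -/
theorem IsResponse.apply_eq {H : L2R →L[ℂ] L2R} {w : 𝓢'(ℝ, ℂ)} {u : L2R} (h : IsResponse H w u)
    {P : 𝓢(ℝ, ℂ) → 𝓢(ℝ, ℂ)}
    (hP : ∀ (f : L2R) (g : 𝓢(ℝ, ℂ)),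
      Lp.toTemperedDistribution (H f) g = Lp.toTemperedDistribution f (P g)) (g : 𝓢(ℝ, ℂ)) :
    Lp.toTemperedDistribution u g = w (P g) := by
  obtain ⟨Q, hQ, hu⟩ := h
  have hPQ : Q g = P g := by
    apply injective_toLp 2 (volume : Measure ℝ)
    refine eq_of_toTemperedDistribution_eq fun f => ?_
    have h1 := hQ (f.toLp 2 volume) g
    rw [hP (f.toLp 2 volume) g, toTemperedDistribution_toLp, toTemperedDistribution_toLp] at h1
    rw [toTemperedDistribution_toLp, toTemperedDistribution_toLp]
    simpa only [mul_comm] using h1.symm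
  rw [hu, hPQ]

/-! ### Explicit formulas for the responses -/

theorem fourierInv_apply_eq_fourier_neg (f : 𝓢(ℝ, ℂ)) (x : ℝ) : 𝓕⁻ f x = 𝓕 f (-x) := by
  rw [fourierInv_apply_eq]
  rfl

theorem fourier_smulLeftCLM_fourierInv (α k : 𝓢(ℝ, ℂ)) :
    𝓕 (smulLeftCLM ℂ α (𝓕⁻ k)) = convolution (ContinuousLinearMap.mul ℂ ℂ) k (𝓕 α) := by
  refine Eq.trans (congrArg 𝓕 ?_) (FourierTransform.fourier_fourierInv_eq
    (convolution (ContinuousLinearMap.mul ℂ ℂ) k (𝓕 α) : 𝓢(ℝ, ℂ)))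
  ext x
  have h : α x = 𝓕⁻ (𝓕 α) x := by rw [FourierTransform.fourierInv_fourier_eq]
  rw [smulLeftCLM_apply_apply α.hasTemperateGrowth, h, fourierInv_apply_eq_fourier_neg,
    fourierInv_apply_eq_fourier_neg, fourierInv_apply_eq_fourier_neg, fourier_convolution,
    pairing_apply_apply, smul_eq_mul, mul_comm]
  rfl

theorem fourierInv_smulLeftCLM_fourier (m k : 𝓢(ℝ, ℂ)) :
    𝓕⁻ (smulLeftCLM ℂ m (𝓕 k)) = convolution (ContinuousLinearMap.mul ℂ ℂ) k (𝓕⁻ m) := by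
  refine Eq.trans (congrArg 𝓕⁻ ?_) (FourierTransform.fourierInv_fourier_eq
    (convolution (ContinuousLinearMap.mul ℂ ℂ) k (𝓕⁻ m) : 𝓢(ℝ, ℂ)))
  ext x
  rw [smulLeftCLM_apply_apply m.hasTemperateGrowth, fourier_convolution,
    pairing_apply_apply, FourierTransform.fourier_fourierInv_eq, smul_eq_mul, mul_comm]
  rfl

theorem norm_sq_eq_of_forall_integral {m : 𝓢(ℝ, ℂ)} {G : ℝ → ℂ} (hG : Continuous G) {C : ℝ} {N : ℕ}
    (hC : 0 ≤ C) (hb : ∀ y, ‖G y‖ ≤ C * (1 + |y|) ^ N) {u : L2R}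
    (hu : ∀ g : 𝓢(ℝ, ℂ), Lp.toTemperedDistribution u g = ∫ y, smulLeftCLM ℂ m g y * G y) :
    ‖u‖ ^ 2 = ∫ y, ‖m y * G y‖ ^ 2 := by
  obtain ⟨D, hD, hm⟩ := one_add_abs_pow_mul_norm_le m N
  have hcont : Continuous fun y => m y * G y := m.continuous.mul hG
  have hle : ∀ y, ‖m y * G y‖ ≤ C * D := fun y => by
    rw [norm_mul]
    calc ‖m y‖ * ‖G y‖ ≤ ‖m y‖ * (C * (1 + |y|) ^ N) := by gcongr; exact hb y
      _ = C * ((1 + |y|) ^ N * ‖m y‖) := by ring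
      _ ≤ _ := by gcongr; exact hm y
  have hL : MemLp (fun y => m y * G y) 2 := by
    refine (memLp_two_iff_integrable_sq_norm hcont.aestronglyMeasurable).2 ?_
    -- One factor of the square is bounded by `C * D`, the other by `C` times the integrable weight.
    refine ((integrable_mul_one_add_abs_pow m N).const_mul (C * D * C)).mono'
      (hcont.norm.pow 2).aestronglyMeasurable (.of_forall fun y => ?_)
    rw [Real.norm_of_nonneg (by positivity), sq]
    calc ‖m y * G y‖ * ‖m y * G y‖ ≤ (C * D) * (‖m y‖ * (C * (1 + |y|) ^ N)) := by
          gcongr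
          · exact hle y
          · rw [norm_mul]
            gcongr
            exact hb y
      _ = _ := by ring
  have huv : u = hL.toLp := eq_of_toTemperedDistribution_eq fun g => by
    rw [hu, Lp.toTemperedDistribution_apply]
    refine integral_congr_ae ?_
    filter_upwards [hL.coeFn_toLp] with y hy
    rw [hy, smulLeftCLM_apply_apply m.hasTemperateGrowth, smul_eq_mul, smul_eq_mul]
    ring
  rw [huv, norm_sq_eq_integral]
  refine integral_congr_ae ?_
  filter_upwards [hL.coeFn_toLp] with y hy
  rw [hy]

/-- The transpose sends `g` to `(m g) * 𝓕 α`, so `apply_convolution` identifies the response as a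
function. -/
theorem norm_sq_response_mulMultiplier {m α : 𝓢(ℝ, ℂ)} {w : 𝓢'(ℝ, ℂ)} {u : L2R}
    (h : IsResponse (mulMultiplier m α) w u) :
    ‖u‖ ^ 2 = ∫ y, ‖m y * w (compSubConstCLM ℂ y (𝓕 α))‖ ^ 2 := by
  obtain ⟨C, N, hC, hb⟩ := w.exists_norm_apply_compSubConstCLM_le (𝓕 α)
  refine norm_sq_eq_of_forall_integral (w.continuous_apply_compSubConstCLM _) hC hb fun g => ?_
  rw [h.apply_eq (fun f g => toTemperedDistribution_mulMultiplier m α g f), mulMultiplierTranspose,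
    fourier_smulLeftCLM_fourierInv, w.apply_convolution]

theorem norm_sq_response_multiplierMul {m α : 𝓢(ℝ, ℂ)} {w : 𝓢'(ℝ, ℂ)} {u : L2R}
    (h : IsResponse (multiplierMul m α) w u) :
    ‖u‖ ^ 2 = ∫ y, ‖α y * (𝓕 w) (compSubConstCLM ℂ y (𝓕⁻ m))‖ ^ 2 := by
  obtain ⟨C, N, hC, hb⟩ := (𝓕 w).exists_norm_apply_compSubConstCLM_le (𝓕⁻ m)
  rw [← MeasureTheory.Lp.norm_fourier_eq u]
  refine norm_sq_eq_of_forall_integral ((𝓕 w).continuous_apply_compSubConstCLM _) hC hb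
    fun g => ?_
  rw [toTemperedDistribution_fourier,
    h.apply_eq (fun f g => toTemperedDistribution_multiplierMul m α g f),
    multiplierMulTranspose, FourierTransform.fourierInv_fourier_eq,
    ← TemperedDistribution.apply_convolution, ← fourierInv_smulLeftCLM_fourier,
    TemperedDistribution.fourier_apply, FourierTransform.fourier_fourierInv_eq]

/-! ### Decay of the responses to translated operators -/

/-- The majorant must be uniform in `x`. Beyond some `R` decay gives `‖G‖ ≤ 1`; if `z + x < R` with
`x ≥ 0`, then `|z + x| ≤ |R| + |z|` and the growth bound suffices. -/
theorem eventually_norm_add_le_atTop {G : ℝ → ℂ} {C : ℝ} {N : ℕ} (hC : 0 ≤ C)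
    (hb : ∀ y, ‖G y‖ ≤ C * (1 + |y|) ^ N) (h0 : Tendsto G atTop (𝓝 0)) :
    ∃ D : ℝ, 0 ≤ D ∧ ∀ᶠ x in atTop, ∀ z, ‖G (z + x)‖ ≤ D * (1 + |z|) ^ N := by
  obtain ⟨R, hR⟩ := eventually_atTop.1 (h0.norm.eventually_le_const (u := 1) (by simp))
  refine ⟨1 + C * (1 + |R|) ^ N, by positivity, ?_⟩
  filter_upwards [eventually_ge_atTop R, eventually_ge_atTop 0] with x hx hx0 z
  have hz : 1 ≤ (1 + |z|) ^ N := one_le_pow₀ (by linarith [abs_nonneg z])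
  rcases le_or_gt R (z + x) with h | h
  · have h1 : 1 ≤ 1 + C * (1 + |R|) ^ N := le_add_of_nonneg_right (by positivity)
    exact (hR _ h).trans (one_le_mul_of_one_le_of_one_le h1 hz)
  · have h1 : 1 + |z + x| ≤ (1 + |R|) * (1 + |z|) := by
      have : |z + x| ≤ |R| + |z| := by
        refine abs_le.2 ⟨?_, ?_⟩ <;>
          linarith [abs_nonneg R, le_abs_self R, neg_abs_le z, abs_nonneg z]
      nlinarith [mul_nonneg (abs_nonneg R) (abs_nonneg z)]
    calc _ ≤ C * (1 + |z + x|) ^ N := hb _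
      _ ≤ C * ((1 + |R|) * (1 + |z|)) ^ N := by gcongr
      _ = C * (1 + |R|) ^ N * (1 + |z|) ^ N := by rw [mul_pow]; ring
      _ ≤ _ := by
        gcongr
        exact le_add_of_nonneg_left zero_le_one

theorem eventually_norm_add_le_atBot {G : ℝ → ℂ} {C : ℝ} {N : ℕ} (hC : 0 ≤ C)
    (hb : ∀ y, ‖G y‖ ≤ C * (1 + |y|) ^ N) (h0 : Tendsto G atBot (𝓝 0)) :
    ∃ D : ℝ, 0 ≤ D ∧ ∀ᶠ x in atBot, ∀ z, ‖G (z + x)‖ ≤ D * (1 + |z|) ^ N := by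
  obtain ⟨D, hD, h⟩ := eventually_norm_add_le_atTop (G := fun y => G (-y)) hC
    (fun y => by simpa using hb (-y)) (h0.comp tendsto_neg_atTop_atBot)
  refine ⟨D, hD, ?_⟩
  filter_upwards [tendsto_neg_atBot_atTop.eventually h] with x hx z
  simpa [add_comm] using hx (-z)

theorem tendsto_integral_translate {l : Filter ℝ} [l.IsCountablyGenerated] {G : ℝ → ℂ}
    (hG : Continuous G) {D : ℝ} {N : ℕ}
    (hb : ∀ᶠ x in l, ∀ z, ‖G (z + x)‖ ≤ D * (1 + |z|) ^ N)
    (h0 : ∀ z, Tendsto (fun x => G (z + x)) l (𝓝 0)) (m : 𝓢(ℝ, ℂ)) :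
    Tendsto (fun x => ∫ y, ‖compSubConstCLM ℂ x m y * G y‖ ^ 2) l (𝓝 0) := by
  have heq : ∀ x, ∫ y, ‖compSubConstCLM ℂ x m y * G y‖ ^ 2 = ∫ z, ‖m z * G (z + x)‖ ^ 2 :=
    fun x => by
      rw [← integral_add_right_eq_self _ x]
      simp
  simp only [heq]
  rw [← integral_zero ℝ ℝ]
  refine tendsto_integral_filter_of_dominated_convergence
    (fun z => SchwartzMap.seminorm ℝ 0 0 m * D ^ 2 * (‖m z‖ * (1 + |z|) ^ (2 * N)))
    (.of_forall fun x => Continuous.aestronglyMeasurable (by fun_prop)) ?_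
    ((integrable_mul_one_add_abs_pow m (2 * N)).const_mul _) (.of_forall fun z => ?_)
  · filter_upwards [hb] with x hx
    refine .of_forall fun z => ?_
    rw [Real.norm_of_nonneg (by positivity), norm_mul, mul_pow]
    calc ‖m z‖ ^ 2 * ‖G (z + x)‖ ^ 2 ≤ ‖m z‖ ^ 2 * (D * (1 + |z|) ^ N) ^ 2 := by
          gcongr
          exact hx z
      _ = ‖m z‖ * (D ^ 2 * (‖m z‖ * (1 + |z|) ^ (2 * N))) := by ring
      _ ≤ SchwartzMap.seminorm ℝ 0 0 m * (D ^ 2 * (‖m z‖ * (1 + |z|) ^ (2 * N))) := by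
          gcongr
          exact norm_le_seminorm ℝ m z
      _ = _ := by ring
  · simpa using (((h0 z).const_mul (m z)).norm.pow 2)

/-! ### Translates of the symbols -/

theorem fourier_compSubConstCLM_apply (f : 𝓢(ℝ, ℂ)) (x ξ : ℝ) :
    𝓕 (compSubConstCLM ℂ x f) ξ = Complex.exp (-(2 * Real.pi * Complex.I * (ξ * x))) * 𝓕 f ξ := by
  rw [fourier_apply_eq_integral, fourier_apply_eq_integral, ← integral_const_mul,
    ← integral_add_right_eq_self _ x]
  congr 1 with t
  rw [compSubConstCLM_apply, add_sub_cancel_right, ← mul_assoc (Complex.exp _), ← Complex.exp_add]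
  congr 2
  push_cast
  ring

theorem fourierInv_compSubConstCLM_apply (f : 𝓢(ℝ, ℂ)) (x ξ : ℝ) :
    𝓕⁻ (compSubConstCLM ℂ x f) ξ = Complex.exp (2 * Real.pi * Complex.I * (ξ * x)) * 𝓕⁻ f ξ := by
  rw [fourierInv_apply_eq_fourier_neg, fourierInv_apply_eq_fourier_neg,
    fourier_compSubConstCLM_apply]
  congr 2
  push_cast
  ring

theorem smulLeftCLM_compSubConstCLM (m g : 𝓢(ℝ, ℂ)) (x : ℝ) :
    smulLeftCLM ℂ (compSubConstCLM ℂ x m) (compSubConstCLM ℂ x g) =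
      compSubConstCLM ℂ x (smulLeftCLM ℂ m g) := by
  ext y
  rw [smulLeftCLM_apply_apply (compSubConstCLM ℂ x m).hasTemperateGrowth, compSubConstCLM_apply,
    compSubConstCLM_apply, compSubConstCLM_apply, smulLeftCLM_apply_apply m.hasTemperateGrowth]

theorem convolution_compSubConstCLM (k φ : 𝓢(ℝ, ℂ)) (x : ℝ) :
    convolution (ContinuousLinearMap.mul ℂ ℂ) (compSubConstCLM ℂ x k) φ =
      compSubConstCLM ℂ x (convolution (ContinuousLinearMap.mul ℂ ℂ) k φ) := by
  ext y
  rw [compSubConstCLM_apply, convolution_mul_apply, convolution_mul_apply,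
    ← integral_add_right_eq_self _ x]
  congr 1 with t
  rw [compSubConstCLM_apply, add_sub_cancel_right]
  congr 2
  ring

theorem mulMultiplierTranspose_compSubConstCLM (m α g : 𝓢(ℝ, ℂ)) (x : ℝ) :
    mulMultiplierTranspose (compSubConstCLM ℂ x m) α (compSubConstCLM ℂ x g) =
      compSubConstCLM ℂ x (mulMultiplierTranspose m α g) := by
  rw [mulMultiplierTranspose, mulMultiplierTranspose, smulLeftCLM_compSubConstCLM,
    fourier_smulLeftCLM_fourierInv, fourier_smulLeftCLM_fourierInv, convolution_compSubConstCLM]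

/-- The matrix coefficients of the translates of `mulMultiplier m α` in time. -/
theorem coefficient_mulMultiplier_compSubConstCLM (m α f g : 𝓢(ℝ, ℂ)) (x : ℝ) :
    Lp.toTemperedDistribution (mulMultiplier (compSubConstCLM ℂ x m) α
        ((compSubConstCLM ℂ x f).toLp 2 volume)) (compSubConstCLM ℂ x g) =
      ∫ y, f y * mulMultiplierTranspose m α g y := by
  rw [toTemperedDistribution_mulMultiplier, mulMultiplierTranspose_compSubConstCLM,
    toTemperedDistribution_toLp]
  simp only [compSubConstCLM_apply]
  rw [integral_sub_right_eq_self fun y => mulMultiplierTranspose m α g y * f y]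
  simp only [mul_comm]

/-- The matrix coefficients of the translates of `multiplierMul m α` in frequency. -/
theorem coefficient_multiplierMul_compSubConstCLM (m α f k : 𝓢(ℝ, ℂ)) (ν : ℝ) :
    Lp.toTemperedDistribution (multiplierMul m (compSubConstCLM ℂ ν α)
        ((𝓕⁻ (compSubConstCLM ℂ ν (𝓕 f))).toLp 2 volume)) (𝓕 (compSubConstCLM ℂ ν k)) =
      ∫ ξ, k ξ * smulLeftCLM ℂ α (𝓕 (smulLeftCLM ℂ m f)) ξ := by
  rw [toTemperedDistribution_multiplierMul, toTemperedDistribution_toLp, multiplierMulTranspose,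
    FourierTransform.fourierInv_fourier_eq, smulLeftCLM_compSubConstCLM]
  calc _ = ∫ x, 𝓕 (smulLeftCLM ℂ α k) x * smulLeftCLM ℂ m f x := by
        congr 1 with x
        -- The shifts by `ν` in frequency become opposite phases in `x`, which cancel.
        rw [smulLeftCLM_apply_apply m.hasTemperateGrowth, fourier_compSubConstCLM_apply,
          fourierInv_compSubConstCLM_apply, smulLeftCLM_apply_apply m.hasTemperateGrowth,
          FourierTransform.fourierInv_fourier_eq, Complex.exp_neg, smul_eq_mul, smul_eq_mul]
        field_simp
    _ = _ := by
        rw [integral_fourier_mul_eq]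
        congr 1 with x
        rw [smulLeftCLM_apply_apply α.hasTemperateGrowth,
          smulLeftCLM_apply_apply α.hasTemperateGrowth, smul_eq_mul, smul_eq_mul]
        ring

/-! ### Choice of the operators -/

/-- A nonnegative bump has positive integral, so both transforms are nonzero at the origin. -/
theorem exists_supported_in_Icc {l r : ℝ} (h : l < r) :
    ∃ b : 𝓢(ℝ, ℂ), (∀ t ∉ Set.Icc l r, b t = 0) ∧ 𝓕 b 0 ≠ 0 ∧ 𝓕⁻ b 0 ≠ 0 := by
  let B : ContDiffBump ((l + r) / 2) :=
    ⟨(r - l) / 4, (r - l) / 2, by linarith, by linarith⟩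
  have hc : HasCompactSupport (Complex.ofRealCLM ∘ B) := B.hasCompactSupport.comp_left rfl
  have hs : ContDiff ℝ (⊤ : ℕ∞) (Complex.ofRealCLM ∘ B) :=
    Complex.ofRealCLM.contDiff.comp B.contDiff
  let b : 𝓢(ℝ, ℂ) := hc.toSchwartzMap hs
  have hb : ∀ t, b t = (B t : ℂ) := fun t => rfl
  have hF : 𝓕 b 0 ≠ 0 := by
    rw [fourier_apply_eq_integral]
    simp only [hb, Complex.ofReal_zero, zero_mul, mul_zero, neg_zero, Complex.exp_zero, one_mul]
    rw [integral_complex_ofReal]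
    exact_mod_cast B.integral_pos.ne'
  refine ⟨b, fun t ht => ?_, hF, ?_⟩
  · rw [hb, B.zero_of_le_dist, Complex.ofReal_zero]
    rw [Real.dist_eq]
    change (r - l) / 2 ≤ _
    by_contra! hlt
    rw [abs_lt] at hlt
    exact ht ⟨by linarith, by linarith⟩
  · rw [fourierInv_apply_eq_fourier_neg, neg_zero]
    exact hF

theorem ne_zero_of_apply_ne_zero {f : 𝓢(ℝ, ℂ)} {x : ℝ} (h : f x ≠ 0) : f ≠ 0 := by
  rintro rfl
  exact h rfl

theorem exists_fourier_smulLeftCLM_ne_zero {m : 𝓢(ℝ, ℂ)} (hm : m ≠ 0) :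
    ∃ f, 𝓕 (smulLeftCLM ℂ m f) 0 ≠ 0 := by
  obtain ⟨f, hf⟩ := exists_integral_mul_ne_zero hm
  refine ⟨f, ?_⟩
  rw [fourier_apply_eq_integral]
  convert hf using 2
  ext x
  simp [smulLeftCLM_apply_apply m.hasTemperateGrowth, mul_comm]

/-- A filter at infinity along which a family of translates can be dominated. -/
structure IsTranslationDirection (l : Filter ℝ) : Prop where
  tendsto_add : ∀ z, Tendsto (fun x => z + x) l l
  eventually_norm_add_le : ∀ (G : ℝ → ℂ) (C : ℝ) (N : ℕ), 0 ≤ C →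
    (∀ y, ‖G y‖ ≤ C * (1 + |y|) ^ N) → Tendsto G l (𝓝 0) →
    ∃ D : ℝ, 0 ≤ D ∧ ∀ᶠ x in l, ∀ z, ‖G (z + x)‖ ≤ D * (1 + |z|) ^ N

theorem isTranslationDirection_atTop : IsTranslationDirection atTop :=
  ⟨fun z => tendsto_atTop_add_const_left _ z tendsto_id,
    fun _ _ _ hC hb h0 => eventually_norm_add_le_atTop hC hb h0⟩

theorem isTranslationDirection_atBot : IsTranslationDirection atBot :=
  ⟨fun z => tendsto_atBot_add_const_left _ z tendsto_id,
    fun _ _ _ hC hb h0 => eventually_norm_add_le_atBot hC hb h0⟩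

theorem tendsto_integral_translate_apply {l : Filter ℝ} [l.IsCountablyGenerated]
    (hl : IsTranslationDirection l) {w : 𝓢'(ℝ, ℂ)} {φ : 𝓢(ℝ, ℂ)}
    (h0 : Tendsto (fun x => w (compSubConstCLM ℂ x φ)) l (𝓝 0)) (m : 𝓢(ℝ, ℂ)) :
    Tendsto (fun x => ∫ y, ‖compSubConstCLM ℂ x m y * w (compSubConstCLM ℂ y φ)‖ ^ 2) l
      (𝓝 0) := by
  obtain ⟨C, N, hC, hb⟩ := w.exists_norm_apply_compSubConstCLM_le φ
  obtain ⟨D, -, hD⟩ := hl.eventually_norm_add_le _ C N hC hb h0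
  exact tendsto_integral_translate (w.continuous_apply_compSubConstCLM φ) hD
    (fun z => h0.comp (hl.tendsto_add z)) m

theorem false_of_tendsto_norm_sq {l : Filter ℝ} [l.NeBot] {u : ℝ → L2R} {c K : ℝ} (hc : 0 < c)
    (hle : ∀ x, c ≤ ‖u x‖ * K) (h0 : Tendsto (fun x => ‖u x‖ ^ 2) l (𝓝 0)) : False := by
  have h1 : Tendsto (fun x => ‖u x‖ ^ 2 * K ^ 2) l (𝓝 0) := by simpa using h0.mul_const (K ^ 2)
  have h2 : c ^ 2 ≤ 0 := ge_of_tendsto' h1 fun x => by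
    rw [← mul_pow]
    exact pow_le_pow_left₀ hc.le (hle x) 2
  exact absurd h2 (not_le.2 (by positivity))

theorem not_tendsto_translate_of_identifies {T Ω : ℝ} (hT : 0 < T) (hΩ : 0 < Ω) {w : 𝓢'(ℝ, ℂ)}
    (hw : Identifies w (rectangle T Ω) ∨ IdentifiesHilbertSchmidt w (rectangle T Ω))
    {l : Filter ℝ} [l.NeBot] [l.IsCountablyGenerated] (hl : IsTranslationDirection l) :
    ¬ ∀ φ : 𝓢(ℝ, ℂ), Tendsto (fun x : ℝ => w (compSubConstCLM ℂ x φ)) l (𝓝 0) := by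
  intro h0
  obtain ⟨A, hA, hlow⟩ := exists_lower_bound_of_identifies hw
  obtain ⟨a, ha, ha0, -⟩ := exists_supported_in_Icc hT
  obtain ⟨b, hb, -, hb0⟩ := exists_supported_in_Icc (show -Ω / 2 < Ω / 2 by linarith)
  set α := 𝓕 a with hα
  set m := 𝓕⁻ b with hm
  -- It is enough that `α · 𝓕⁻ (m g)` is nonzero at 0: there `α` is nonzero by `ha0`, and `g` is
  -- chosen with `∫ m g ≠ 0`.
  obtain ⟨g, hg⟩ : ∃ g, mulMultiplierTranspose m α g ≠ 0 := by
    obtain ⟨g, hg⟩ := exists_fourier_smulLeftCLM_ne_zero (ne_zero_of_apply_ne_zero hb0)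
    refine ⟨g, fun h => ?_⟩
    have h1 : smulLeftCLM ℂ α (𝓕⁻ (smulLeftCLM ℂ m g)) 0 = 0 := by
      have h2 := congrArg (𝓕⁻ : 𝓢(ℝ, ℂ) → 𝓢(ℝ, ℂ)) h
      rw [mulMultiplierTranspose, FourierTransform.fourierInv_fourier_eq,
        FourierTransform.fourierInv_zero] at h2
      rw [h2]
      rfl
    rw [smulLeftCLM_apply_apply α.hasTemperateGrowth, fourierInv_apply_eq_fourier_neg,
      neg_zero] at h1
    exact mul_ne_zero ha0 hg h1
  obtain ⟨f, hf⟩ := exists_integral_mul_ne_zero hg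
  -- Translating `m` modulates `𝓕 m`, so its support is unchanged.
  have hmem : ∀ x, mulMultiplier (compSubConstCLM ℂ x m) α ∈ OPW (rectangle T Ω) := fun x => by
    refine mulMultiplier_mem_OPW (fun t ht => ?_) fun γ hγ => ?_
    · rw [hα, FourierTransform.fourierInv_fourier_eq, ha t ht]
    · rw [fourier_compSubConstCLM_apply, hm, FourierTransform.fourier_fourierInv_eq, hb γ hγ,
        mul_zero]
  choose u hu hle using fun x => hlow _ (hmem x) _ (isKNSymbol_mulMultiplier _ _)
  refine false_of_tendsto_norm_sq (l := l) (u := u) (mul_pos hA (norm_pos_iff.2 hf))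
    (K := ‖f.toLp 2 volume‖ * ‖g.toLp 2 volume‖) (fun x => ?_) ?_
  · have h := hle x (compSubConstCLM ℂ x f) (compSubConstCLM ℂ x g)
    rwa [coefficient_mulMultiplier_compSubConstCLM, norm_toLp_compSubConstCLM,
      norm_toLp_compSubConstCLM] at h
  · simp only [fun x => norm_sq_response_mulMultiplier (hu x)]
    exact tendsto_integral_translate_apply hl (h0 _) m

/-- Here the multiplier acts last, so the translated `α` localizes the Fourier transform of the
response near `ν`. -/
theorem not_tendsto_translate_fourier_of_identifies {T Ω : ℝ} (hT : 0 < T) (hΩ : 0 < Ω)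
    {w : 𝓢'(ℝ, ℂ)}
    (hw : Identifies w (rectangle T Ω) ∨ IdentifiesHilbertSchmidt w (rectangle T Ω))
    {l : Filter ℝ} [l.NeBot] [l.IsCountablyGenerated] (hl : IsTranslationDirection l) :
    ¬ ∀ φ : 𝓢(ℝ, ℂ), Tendsto (fun ξ : ℝ => (𝓕 w) (compSubConstCLM ℂ ξ φ)) l (𝓝 0) := by
  intro h0
  obtain ⟨A, hA, hlow⟩ := exists_lower_bound_of_identifies hw
  obtain ⟨a, ha, ha0, -⟩ := exists_supported_in_Icc hT
  obtain ⟨b, hb, -, hb0⟩ := exists_supported_in_Icc (show -Ω / 2 < Ω / 2 by linarith)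
  set α := 𝓕 a with hα
  set m := 𝓕⁻ b with hm
  obtain ⟨f, hf⟩ := exists_fourier_smulLeftCLM_ne_zero (ne_zero_of_apply_ne_zero hb0)
  have hαf : smulLeftCLM ℂ α (𝓕 (smulLeftCLM ℂ m f)) ≠ 0 := by
    refine ne_zero_of_apply_ne_zero (x := 0) ?_
    rw [smulLeftCLM_apply_apply α.hasTemperateGrowth]
    exact mul_ne_zero ha0 hf
  obtain ⟨k, hk⟩ := exists_integral_mul_ne_zero hαf
  have hmem : ∀ ν, multiplierMul m (compSubConstCLM ℂ ν α) ∈ OPW (rectangle T Ω) := fun ν => by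
    refine multiplierMul_mem_OPW (fun t ht => ?_) fun γ hγ => ?_
    · rw [fourierInv_compSubConstCLM_apply, hα, FourierTransform.fourierInv_fourier_eq, ha t ht,
        mul_zero]
    · rw [hm, FourierTransform.fourier_fourierInv_eq, hb γ hγ]
  choose u hu hle using fun ν => hlow _ (hmem ν) _ (isKNSymbol_multiplierMul _ _)
  refine false_of_tendsto_norm_sq (l := l) (u := u) (mul_pos hA (norm_pos_iff.2 hk))
    (K := ‖f.toLp 2 volume‖ * ‖k.toLp 2 volume‖) (fun ν => ?_) ?_
  -- These test functions follow the frequency shift of the operator: their coefficient is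
  -- independent of `ν`, and by Plancherel so are their norms.
  · have h := hle ν (𝓕⁻ (compSubConstCLM ℂ ν (𝓕 f))) (𝓕 (compSubConstCLM ℂ ν k))
    rwa [coefficient_multiplierMul_compSubConstCLM, norm_toLp_fourierInv, norm_toLp_fourier,
      norm_toLp_compSubConstCLM, norm_toLp_compSubConstCLM, norm_toLp_fourier] at h
  · simp only [fun ν => norm_sq_response_multiplierMul (hu ν)]
    exact tendsto_integral_translate_apply hl (h0 _) α

end OperatorPW

end

theorem theorem4p2 (T Ω : ℝ) (hT : 0 < T) (hΩ : 0 < Ω) (w : 𝓢'(ℝ, ℂ))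
    (hw : OperatorPW.Identifies w (OperatorPW.rectangle T Ω) ∨
      OperatorPW.IdentifiesHilbertSchmidt w (OperatorPW.rectangle T Ω)) :
    (¬ ∀ φ : 𝓢(ℝ, ℂ),
      Tendsto (fun x : ℝ => w (SchwartzMap.compSubConstCLM ℂ x φ)) atTop (𝓝 0)) ∧
    (¬ ∀ φ : 𝓢(ℝ, ℂ),
      Tendsto (fun x : ℝ => w (SchwartzMap.compSubConstCLM ℂ x φ)) atBot (𝓝 0)) ∧
    (¬ ∀ φ : 𝓢(ℝ, ℂ),
      Tendsto (fun ξ : ℝ => (𝓕 w) (SchwartzMap.compSubConstCLM ℂ ξ φ)) atTop (𝓝 0)) ∧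
    (¬ ∀ φ : 𝓢(ℝ, ℂ),
      Tendsto (fun ξ : ℝ => (𝓕 w) (SchwartzMap.compSubConstCLM ℂ ξ φ)) atBot (𝓝 0)) :=
  ⟨OperatorPW.not_tendsto_translate_of_identifies hT hΩ hw
      OperatorPW.isTranslationDirection_atTop,
    OperatorPW.not_tendsto_translate_of_identifies hT hΩ hw
      OperatorPW.isTranslationDirection_atBot,
    OperatorPW.not_tendsto_translate_fourier_of_identifies hT hΩ hw
      OperatorPW.isTranslationDirection_atTop,
    OperatorPW.not_tendsto_translate_fourier_of_identifies hT hΩ hw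
      OperatorPW.isTranslationDirection_atBot⟩
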